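/- Let $\mathrm{sn}(\cdot)=\mathrm{sn}(\cdot,k)$ be the Jacobi elliptic function with modulus $k\in\mathbb{C}$, i.e. the meromorphic function with $\mathrm{sn}(0)=0$, $\mathrm{sn}'(0)=1$, $(\mathrm{sn}')^2=(1-\mathrm{sn}^2)(1-k^2\mathrm{sn}^2)$, let $\sqrt{k}$ be either square root of $k$, and let $$\mathcal{Q}_{\alpha,\beta}(x_1,x_2,x_3,x_4)=\mathrm{sn}(\alpha)(x_1x_2+x_3x_4)-\mathrm{sn}(\beta)(x_1x_3+x_2x_4)-\mathrm{sn}(\alpha-\beta)\bigl(x_1x_4+x_2x_3-k\,\mathrm{sn}(\alpha)\,\mathrm{sn}(\beta)(1+x_1x_2x_3x_4)\bigr).$$ Let $\alpha,\beta,\gamma,\kappa,\zeta_0\in\mathbb{C}$ be such that the polynomials $\mathcal{B}_1=\mathcal{Q}_{\alpha,\kappa}$, $\mathcal{B}_2=\mathcal{Q}_{\beta,\kappa}$, $\mathcal{B}_3=\mathcal{Q}_{\gamma,\kappa}$, $\mathcal{P}_{12}=\mathcal{Q}_{\alpha,\beta}$, $\mathcal{P}_{23}=\mathcal{Q}_{\beta,\gamma}$,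 $\mathcal{P}_{31}=\mathcal{Q}_{\gamma,\alpha}$ are defined (no argument of $\mathrm{sn}$ occurring in them is a pole). For functions on $\mathbb{Z}^3$, with coordinates $(n,m,l)$, let $\tilde{\ }$, $\hat{\ }$, $\bar{\ }$ denote the unit shifts in $n$, $m$, $l$. Polynomial equations of degree one in each variable are understood on $\mathbb{C}\cup\{\infty\}$ by homogenisation. Let $u:\mathbb{Z}^3\to\mathbb{C}\cup\{\infty\}$ be a solution of $$\mathcal{P}_{12}(u,\tilde u,\hat u,\hat{\tilde u})=0,\qquad \mathcal{P}_{23}(u,\hat u,\bar u,\bar{\hat u})=0,\qquad \mathcal{P}_{31}(u,\bar u,\tilde u,\tilde{\bar u})=0$$ that is non-singular: $\mathcal{H}_1(u,\tilde u)\ne0$, $\mathcal{H}_2(u,\hat u)\neq0$, $\mathcal{H}_3(u,\bar u)\neq0$ throughout $\mathbb{Z}^3$, where $\mathcal{H}_i=(\partial_3\mathcal{B}_i)(\partial_4\mathcal{B}_i)-(\partial_3\partial_4\mathcal{B}_i)\mathcal{B}_i$ (a polynomial in the first two variables, of degree at most two in each). Let $\mathsf{r}_1,\mathsf{r}_2,\mathsf{r}_3$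 be the Möbius transformations $v\mapsto\tilde v$, $v\mapsto\hat v$, $v\mapsto\bar v$ defined by $\mathcal{B}_1(u,\tilde u,v,\tilde v)=0$, $\mathcal{B}_2(u,\hat u,v,\hat v)=0$, $\mathcal{B}_3(u,\bar u,v,\bar v)=0$, let $\mathsf{s}$ be a function from $\mathbb{Z}^3$ to the group of Möbius transformations with $\tilde{\mathsf{s}}=\mathsf{r}_1\cdot\mathsf{s}$, $\hat{\mathsf{s}}=\mathsf{r}_2\cdot\mathsf{s}$, $\bar{\mathsf{s}}=\mathsf{r}_3\cdot\mathsf{s}$, and let $$\varphi=\mathsf{s}^{-1}(w),\qquad w=\sqrt{k}\,\mathrm{sn}(\zeta_0+n\alpha+m\beta+l\gamma)$$ be the associated Schwarzian variable. Then $\varphi$ satisfies the lattice Schwarzian KP equation $$\frac{(\hat\varphi-\hat{\tilde\varphi})(\bar\varphi-\bar{\hat\varphi})(\tilde\varphi-\tilde{\bar\varphi})}{(\tilde\varphi-\hat{\tilde\varphi})(\hat\varphi-\bar{\hat\varphi})(\bar\varphi-\tilde{\bar\varphi})}=1$$ throughout $\mathbb{Z}^3$: numerator and denominator (homogenised, where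 values are $\infty$) are equal, and hence the quotient is $1$ wherever the denominator does not vanish. -/

import Mathlib

open Filter Topology

/-! ### The Jacobi elliptic function `sn` with modulus `k` -/

/-- `f` is the Jacobi function `sn(·, k)`: the meromorphic function on `ℂ` with `f 0 = 0`,
`f' 0 = 1` and `(f')² = (1 - f²) (1 - k² f²)` away from its poles.
Normal form (`MeromorphicNFAt`) means that `f` is analytic at `z` unless it has a pole at `z`,
and that `f` has the value `0` at its poles; this makes `f` unique (`IsJacobiSn.unique`). -/
structure IsJacobiSn (k : ℂ) (f : ℂ → ℂ) : Prop where
  meromorphicNFAt : ∀ z, MeromorphicNFAt f z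
  analyticAt_zero : AnalyticAt ℂ f 0
  map_zero : f 0 = 0
  deriv_zero : deriv f 0 = 1
  ode : ∀ z, AnalyticAt ℂ f z → deriv f z ^ 2 = (1 - f z ^ 2) * (1 - k ^ 2 * f z ^ 2)

/-- The germ at `0` of `sn(·, k)`; used only to construct `sn`. -/
structure IsLocalSn (k : ℂ) (f : ℂ → ℂ) : Prop where
  analyticAt_zero : AnalyticAt ℂ f 0
  map_zero : f 0 = 0
  deriv_zero : deriv f 0 = 1
  ode : ∀ᶠ z in 𝓝 0, deriv f z ^ 2 = (1 - f z ^ 2) * (1 - k ^ 2 * f z ^ 2)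

/-- The germ of `sn` exists (as the inverse of the elliptic integral) and is unique. -/
theorem exists_isLocalSn (k : ℂ) :
    ∃ s, IsLocalSn k s ∧ ∀ f, IsLocalSn k f → f =ᶠ[𝓝 0] s := by
  let h : ℂ → ℂ := fun t => (1 - t ^ 2) * (1 - k ^ 2 * t ^ 2)
  let G : ℂ → ℂ := fun t => Complex.exp (-(1 / 2) * Complex.log (h t))
  have hh : AnalyticAt ℂ h 0 := by fun_prop
  have h0 : h 0 = 1 := by simp [h]
  have hG : AnalyticAt ℂ G 0 := by
    have : h 0 ∈ Complex.slitPlane := by rw [h0]; exact Complex.one_mem_slitPlane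
    have := hh.clog this
    fun_prop
  have hG0 : G 0 = 1 := by simp [G, h0]
  have hGh : ∀ᶠ t in 𝓝 0, G t ^ 2 * h t = 1 := by
    have : ∀ᶠ t in 𝓝 0, h t ≠ 0 := hh.continuousAt.eventually_ne (by simp [h0])
    filter_upwards [this] with t ht
    have : G t ^ 2 = (h t)⁻¹ := by
      simp only [G]
      rw [← Complex.exp_nat_mul, ← Complex.exp_log (inv_ne_zero ht), Complex.exp_log (inv_ne_zero ht),
        show ((2 : ℕ) : ℂ) * (-(1 / 2) * Complex.log (h t)) = - Complex.log (h t) by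
          push_cast; ring, Complex.exp_neg, Complex.exp_log ht]
    rw [this, inv_mul_cancel₀ ht]
  obtain ⟨F, hF0, hF⟩ : ∃ F : ℂ → ℂ, F 0 = 0 ∧ ∀ᶠ t in 𝓝 0, HasDerivAt F (G t) t := by
    obtain ⟨r, hr, hr'⟩ := Metric.eventually_nhds_iff_ball.1 hG.eventually_analyticAt
    have : DifferentiableOn ℂ G (Metric.ball 0 r) :=
      fun z hz => (hr' z hz).differentiableAt.differentiableWithinAt
    obtain ⟨F, hF0, hF⟩ := this.isExactOn_ball.with_val_at 0 0
    exact ⟨F, hF0, Metric.eventually_nhds_iff_ball.2 ⟨r, hr, hF⟩⟩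
  have hFa : AnalyticAt ℂ F 0 := by
    rw [Complex.analyticAt_iff_eventually_differentiableAt]
    exact hF.mono fun z hz => hz.differentiableAt
  have hFd : deriv F 0 = 1 := by rw [hF.self_of_nhds.deriv, hG0]
  have hFd' : deriv F 0 ≠ 0 := by simp [hFd]
  let s : ℂ → ℂ := hFa.hasStrictDerivAt.localInverse _ _ _ hFd'
  have hsa : AnalyticAt ℂ s 0 := by
    have := hFa.analyticAt_localInverse hFd'
    rwa [hF0] at this
  have hFs : ∀ᶠ z in 𝓝 0, F (s z) = z := by
    have := hFa.hasStrictDerivAt.eventually_right_inverse hFd'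
    rwa [hF0] at this
  have hsF : ∀ᶠ z in 𝓝 0, s (F z) = z := hFa.hasStrictDerivAt.eventually_left_inverse hFd'
  have hs0 : s 0 = 0 := by simpa [hF0] using hsF.self_of_nhds
  have hst : Tendsto s (𝓝 0) (𝓝 0) := by simpa [hs0] using hsa.continuousAt.tendsto
  have hsd : ∀ᶠ z in 𝓝 0, G (s z) * deriv s z = 1 := by
    filter_upwards [hst.eventually hF, hsa.eventually_analyticAt, hFs.eventually_nhds]
      with z h1 h2 h3
    have h4 := h1.comp z h2.differentiableAt.hasDerivAt
    exact (h4.congr_of_eventuallyEq (EventuallyEq.symm h3)).unique (hasDerivAt_id z)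
  refine ⟨s, ⟨hsa, hs0, ?_, ?_⟩, ?_⟩
  · simpa [hs0, hG0] using hsd.self_of_nhds
  · filter_upwards [hsd, hst.eventually hGh] with z h1 h2
    change _ = h (s z)
    linear_combination (-deriv s z ^ 2) * h2 + h (s z) * (G (s z) * deriv s z + 1) * h1
  · intro f hf
    have hft : Tendsto f (𝓝 0) (𝓝 0) := by
      simpa [hf.map_zero] using hf.analyticAt_zero.continuousAt.tendsto
    have h1 : ∀ᶠ z in 𝓝 0, G (f z) * deriv f z = 1 := by
      have hne : ∀ᶠ z in 𝓝 0, G (f z) * deriv f z + 1 ≠ 0 := by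
        have h3 : ContinuousAt (fun z => G (f z) * deriv f z + 1) 0 := by
          have h4 : ContinuousAt G (f 0) := by rw [hf.map_zero]; exact hG.continuousAt
          have := ContinuousAt.comp h4 hf.analyticAt_zero.continuousAt
          exact (this.mul hf.analyticAt_zero.deriv.continuousAt).add continuousAt_const
        apply h3.eventually_ne
        simp only [hf.map_zero, hG0, hf.deriv_zero]
        norm_num
      filter_upwards [hne, hf.ode, hft.eventually hGh] with z h3 h4 h5
      have h6 : (G (f z) * deriv f z + 1) * (G (f z) * deriv f z - 1) = 0 := by
        change _ = h (f z) at h4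
        linear_combination G (f z) ^ 2 * h4 + h5
      rcases mul_eq_zero.1 h6 with h7 | h7
      · exact absurd h7 h3
      · linear_combination h7
    have h2 : ∀ᶠ z in 𝓝 0, F (f z) = z := by
      have h3 : ∀ᶠ z in 𝓝 (0 : ℂ), HasDerivAt (fun z => F (f z) - z) 0 z := by
        filter_upwards [h1, hft.eventually hF, hf.analyticAt_zero.eventually_analyticAt]
          with z h4 h5 h6
        have := (h5.comp z h6.differentiableAt.hasDerivAt).sub (hasDerivAt_id z)
        rwa [h4, sub_self] at this
      obtain ⟨r, hr, hr'⟩ := Metric.eventually_nhds_iff_ball.1 h3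
      rw [Metric.eventually_nhds_iff_ball]
      refine ⟨r, hr, fun z hz => ?_⟩
      have := Metric.isOpen_ball.is_const_of_deriv_eq_zero
        (convex_ball (0 : ℂ) r).isPreconnected
        (fun y hy => (hr' y hy).differentiableAt.differentiableWithinAt)
        (fun y hy => (hr' y hy).deriv) hz (Metric.mem_ball_self hr)
      simp only [hf.map_zero, hF0] at this
      linear_combination this
    filter_upwards [h2, hft.eventually hsF] with z h3 h4
    rw [h3] at h4
    exact h4.symm

/-- The second order equation of the germ. -/
theorem IsLocalSn.ode2 {k : ℂ} {s : ℂ → ℂ} (hs : IsLocalSn k s) :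
    ∀ᶠ z in 𝓝 0, deriv (deriv s) z = -(1 + k ^ 2) * s z + 2 * k ^ 2 * s z ^ 3 := by
  have hne : ∀ᶠ z in 𝓝 0, deriv s z ≠ 0 :=
    hs.analyticAt_zero.deriv.continuousAt.eventually_ne (by simp [hs.deriv_zero])
  filter_upwards [hne, hs.ode.eventually_nhds, hs.analyticAt_zero.eventually_analyticAt]
    with z h1 h2 h3
  have h4 := h3.differentiableAt.hasDerivAt
  have h5 := h3.deriv.differentiableAt.hasDerivAt
  have h6 := (h5.pow 2).congr_of_eventuallyEq (EventuallyEq.symm h2)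
  have h7 := ((h4.pow 2).const_sub 1).mul (((h4.pow 2).const_mul (k ^ 2)).const_sub 1)
  have h8 := h6.unique h7
  simp at h8
  apply mul_left_cancel₀ h1
  linear_combination h8 / 2

/-- The duplication formula: the doubled function is again the germ of `sn`. -/
theorem IsLocalSn.double {k : ℂ} {s : ℂ → ℂ} (hs : IsLocalSn k s) :
    IsLocalSn k
      (fun z => 2 * s (z / 2) * deriv s (z / 2) / (1 - k ^ 2 * s (z / 2) ^ 4)) := by
  have hd : Tendsto (fun z : ℂ => z / 2) (𝓝 0) (𝓝 0) := by
    have : ContinuousAt (fun z : ℂ => z / 2) 0 := by fun_prop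
    simpa using this.tendsto
  have key : ∀ᶠ z in 𝓝 0,
      HasDerivAt (fun z => 2 * s (z / 2) * deriv s (z / 2) / (1 - k ^ 2 * s (z / 2) ^ 4))
        ((((1 - s (z / 2) ^ 2) * (1 - k ^ 2 * s (z / 2) ^ 2)
            + s (z / 2) * (-(1 + k ^ 2) * s (z / 2) + 2 * k ^ 2 * s (z / 2) ^ 3)) *
            (1 - k ^ 2 * s (z / 2) ^ 4)
          + 4 * k ^ 2 * s (z / 2) ^ 4 * ((1 - s (z / 2) ^ 2) * (1 - k ^ 2 * s (z / 2) ^ 2))) /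
          (1 - k ^ 2 * s (z / 2) ^ 4) ^ 2) z ∧ 1 - k ^ 2 * s (z / 2) ^ 4 ≠ 0 ∧
      deriv s (z / 2) ^ 2 = (1 - s (z / 2) ^ 2) * (1 - k ^ 2 * s (z / 2) ^ 2) := by
    have hne : ∀ᶠ z in 𝓝 0, 1 - k ^ 2 * s z ^ 4 ≠ 0 := by
      have : ContinuousAt (fun z => 1 - k ^ 2 * s z ^ 4) 0 := by
        have := hs.analyticAt_zero.continuousAt
        fun_prop
      exact this.eventually_ne (by simp [hs.map_zero])
    filter_upwards [hd.eventually hne, hd.eventually hs.ode, hd.eventually hs.ode2,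
      hd.eventually hs.analyticAt_zero.eventually_analyticAt] with z h1 h2 h3 h4
    refine ⟨?_, h1, h2⟩
    have hz : HasDerivAt (fun z : ℂ => z / 2) (1 / 2) z := (hasDerivAt_id z).div_const 2
    have h5 : HasDerivAt (fun z => s (z / 2)) (deriv s (z / 2) * (1 / 2)) z :=
      h4.differentiableAt.hasDerivAt.comp z hz
    have h6 : HasDerivAt (fun z => deriv s (z / 2)) (deriv (deriv s) (z / 2) * (1 / 2)) z :=
      HasDerivAt.comp (h₂ := deriv s) z h4.deriv.differentiableAt.hasDerivAt hz
    have h7 := ((h5.const_mul 2).mul h6).div (((h5.pow 4).const_mul (k ^ 2)).const_sub 1) h1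
    refine h7.congr_deriv ?_
    congr 1
    rw [h3]
    simp
    linear_combination (1 - k ^ 2 * s (z / 2) ^ 4 + 4 * k ^ 2 * s (z / 2) ^ 4) * h2
  refine ⟨?_, by simp [hs.map_zero], ?_, ?_⟩
  · rw [Complex.analyticAt_iff_eventually_differentiableAt]
    exact key.mono fun z hz => hz.1.differentiableAt
  · rw [key.self_of_nhds.1.deriv]
    simp [hs.map_zero]
  · filter_upwards [key] with z ⟨h1, h2, h3⟩
    rw [h1.deriv]
    simp only [div_pow, mul_pow, h3]
    generalize s (z / 2) = x at h2 ⊢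
    have h4 : (1 - k ^ 2 * x ^ 4) ^ 2 ≠ 0 := pow_ne_zero 2 h2
    rw [one_sub_div h4, mul_div_assoc', one_sub_div h4, div_mul_div_comm, ← pow_two]
    congr 1
    ring

/-- Identity theorem for meromorphic functions on a disk. -/
theorem MeromorphicOn.eventually_eq_zero_of_ball {g : ℂ → ℂ} {R : ℝ}
    (hg : MeromorphicOn g (Metric.ball 0 R)) (h0 : ∀ᶠ z in 𝓝 0, g z = 0) {z : ℂ}
    (hz : z ∈ Metric.ball 0 R) : ∀ᶠ y in 𝓝[≠] z, g y = 0 := by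
  have hR : 0 < R := lt_of_le_of_lt (norm_nonneg z) (by simpa using hz)
  by_contra hcon
  rw [← meromorphicOrderAt_eq_top_iff] at hcon
  refine hg.meromorphicOrderAt_ne_top_of_isPreconnected
    (convex_ball (0 : ℂ) R).isPreconnected hz (Metric.mem_ball_self hR) hcon ?_
  rw [meromorphicOrderAt_eq_top_iff]
  exact h0.filter_mono nhdsWithin_le_nhds

/-- `sn` exists for every modulus: continue the germ by the duplication formula. -/
theorem exists_isJacobiSn (k : ℂ) : ∃ f, IsJacobiSn k f := by
  obtain ⟨s, hs, huniq⟩ := exists_isLocalSn k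
  obtain ⟨r, hr, hr'⟩ :=
    Metric.eventually_nhds_iff_ball.1 hs.analyticAt_zero.eventually_analyticAt
  have hd : Tendsto (fun z : ℂ => z / 2) (𝓝 0) (𝓝 0) := by
    have : ContinuousAt (fun z : ℂ => z / 2) 0 := by fun_prop
    simpa using this.tendsto
  have step : ∀ n : ℕ, ∃ f, MeromorphicOn f (Metric.ball 0 (2 ^ n * r)) ∧ f =ᶠ[𝓝 0] s := by
    intro n
    induction n with
    | zero => exact ⟨s, fun z hz => (hr' z (by simpa using hz)).meromorphicAt, .rfl⟩
    | succ n ih =>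
      obtain ⟨f, hf, hfs⟩ := ih
      refine ⟨fun z => 2 * f (z / 2) * deriv f (z / 2) / (1 - k ^ 2 * f (z / 2) ^ 4), ?_, ?_⟩
      · intro z hz
        have hz' : z / 2 ∈ Metric.ball (0 : ℂ) (2 ^ n * r) := by
          simp only [mem_ball_zero_iff, norm_div, Complex.norm_ofNat] at hz ⊢
          rw [pow_succ] at hz
          linarith
        have h1 : MeromorphicAt (fun z => f (z / 2)) z :=
          (hf _ hz').comp_analyticAt (g := fun z : ℂ => z / 2) (by fun_prop)
        have h2 : MeromorphicAt (fun z => deriv f (z / 2)) z :=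
          (hf _ hz').deriv.comp_analyticAt (g := fun z : ℂ => z / 2) (by fun_prop)
        exact (((MeromorphicAt.const 2 z).mul h1).mul h2).div
          ((MeromorphicAt.const 1 z).sub ((MeromorphicAt.const (k ^ 2) z).mul (h1.pow 4)))
      · have h1 : deriv f =ᶠ[𝓝 0] deriv s := hfs.deriv
        have h2 := huniq _ hs.double
        filter_upwards [hd.eventually hfs, hd.eventually h1, h2] with z h3 h4 h5
        rw [h3, h4, h5]
  have all : ∀ R : ℝ, ∃ f, MeromorphicNFOn f (Metric.ball 0 R) ∧ (0 < R → f =ᶠ[𝓝 0] s) := by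
    intro R
    obtain ⟨n, hn⟩ := pow_unbounded_of_one_lt (R / r) (one_lt_two)
    have hn' : R ≤ 2 ^ n * r := by rw [div_lt_iff₀ hr] at hn; exact hn.le
    obtain ⟨f, hf, hfs⟩ := step n
    have hf' := hf.mono_set (Metric.ball_subset_ball hn')
    refine ⟨toMeromorphicNFOn f (Metric.ball 0 R), meromorphicNFOn_toMeromorphicNFOn f _,
      fun hR => ?_⟩
    have h0 : (0 : ℂ) ∈ Metric.ball (0 : ℂ) R := Metric.mem_ball_self hR
    have h1 := hf'.toMeromorphicNFOn_eq_self_on_nhdsNE h0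
    exact ((meromorphicNFOn_toMeromorphicNFOn f (Metric.ball 0 R)
      h0).eventuallyEq_nhdsNE_iff_eventuallyEq_nhds hs.analyticAt_zero.meromorphicNFAt).1
      (h1.trans (hfs.filter_mono nhdsWithin_le_nhds))
  choose F hF hFs using all
  have agree : ∀ (R R' : ℝ) (z : ℂ), ‖z‖ < R → ‖z‖ < R' → F R =ᶠ[𝓝 z] F R' := by
    intro R R' z hz hz'
    have hR : 0 < R := (norm_nonneg z).trans_lt hz
    have hR' : 0 < R' := (norm_nonneg z).trans_lt hz'
    have h1 : MeromorphicOn (F R - F R') (Metric.ball 0 (min R R')) :=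
      ((hF R).meromorphicOn.mono_set (Metric.ball_subset_ball (min_le_left _ _))).sub
        ((hF R').meromorphicOn.mono_set (Metric.ball_subset_ball (min_le_right _ _)))
    have h2 : ∀ᶠ z in 𝓝 0, (F R - F R') z = 0 := by
      filter_upwards [hFs R hR, hFs R' hR'] with z h3 h4
      simp [h3, h4]
    have h3 := h1.eventually_eq_zero_of_ball h2 (z := z) (by simp [hz, hz'])
    refine ((hF R (by simpa using hz)).eventuallyEq_nhdsNE_iff_eventuallyEq_nhds
      (hF R' (by simpa using hz'))).1 ?_
    filter_upwards [h3] with y hy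
    exact sub_eq_zero.1 hy
  let f : ℂ → ℂ := fun z => F (‖z‖ + 1) z
  have hf : ∀ z, f =ᶠ[𝓝 z] F (‖z‖ + 1) := by
    intro z
    have : ∀ᶠ y in 𝓝 z, ‖y‖ < ‖z‖ + 1 :=
      continuous_norm.continuousAt.eventually_lt continuousAt_const (by simp)
    filter_upwards [this] with y hy
    exact (agree (‖y‖ + 1) (‖z‖ + 1) y (by linarith) hy).self_of_nhds
  have hnf : ∀ z, MeromorphicNFAt f z := fun z =>
    (meromorphicNFAt_congr (hf z)).2 (hF (‖z‖ + 1) (by simp))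
  have hfs : f =ᶠ[𝓝 0] s := (hf 0).trans (hFs _ (by simp))
  refine ⟨f, hnf, hs.analyticAt_zero.congr hfs.symm, ?_, ?_, ?_⟩
  · rw [hfs.self_of_nhds, hs.map_zero]
  · rw [hfs.deriv_eq, hs.deriv_zero]
  · intro z hz
    let g : ℂ → ℂ := fun y => deriv f y ^ 2 - (1 - f y ^ 2) * (1 - k ^ 2 * f y ^ 2)
    have h1 : MeromorphicOn g (Metric.ball 0 (‖z‖ + 1)) := by
      intro y _
      have h2 := (hnf y).meromorphicAt
      have h3 := h2.deriv
      fun_prop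
    have h2 : ∀ᶠ y in 𝓝 0, g y = 0 := by
      filter_upwards [hfs, hfs.deriv, hs.ode] with y h3 h4 h5
      simp only [g, h3, h4, h5, sub_self]
    have h3 := h1.eventually_eq_zero_of_ball h2 (z := z) (by simp)
    have h4 : ContinuousAt g z := by
      have h5 := hz.continuousAt
      have h6 := hz.deriv.continuousAt
      fun_prop
    have h5 := (h4.eventuallyEq_nhds_iff_eventuallyEq_nhdsNE
      (continuousAt_const (y := (0 : ℂ)))).1 h3
    exact sub_eq_zero.1 h5.self_of_nhds

theorem IsJacobiSn.unique {k : ℂ} {f g : ℂ → ℂ} (hf : IsJacobiSn k f) (hg : IsJacobiSn k g) :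
    f = g := by
  have loc : ∀ {h : ℂ → ℂ}, IsJacobiSn k h → IsLocalSn k h := fun hh =>
    ⟨hh.analyticAt_zero, hh.map_zero, hh.deriv_zero,
      hh.analyticAt_zero.eventually_analyticAt.mono hh.ode⟩
  obtain ⟨s, -, huniq⟩ := exists_isLocalSn k
  have h0 : ∀ᶠ z in 𝓝 0, (f - g) z = 0 := by
    filter_upwards [huniq f (loc hf), huniq g (loc hg)] with z h1 h2
    simp [h1, h2]
  funext z
  have h1 : MeromorphicOn (f - g) (Metric.ball 0 (‖z‖ + 1)) := fun y _ =>
    (hf.meromorphicNFAt y).meromorphicAt.sub (hg.meromorphicNFAt y).meromorphicAt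
  have h2 := h1.eventually_eq_zero_of_ball h0 (z := z) (by simp)
  refine (((hf.meromorphicNFAt z).eventuallyEq_nhdsNE_iff_eventuallyEq_nhds
    (hg.meromorphicNFAt z)).1 ?_).self_of_nhds
  filter_upwards [h2] with y hy
  exact sub_eq_zero.1 hy

/-- The complex-valued function `sn(·, k)`, with the value `0` at the poles. -/
noncomputable def jacobiSnFun (k : ℂ) : ℂ → ℂ := Classical.choose (exists_isJacobiSn k)

theorem jacobiSnFun_spec (k : ℂ) : IsJacobiSn k (jacobiSnFun k) :=
  Classical.choose_spec (exists_isJacobiSn k)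

open Classical in
/-- The Jacobi function `sn(·, k) : ℂ → ℂ ∪ {∞}`, with the value `∞` at the poles. -/
noncomputable def jacobiSn (k z : ℂ) : OnePoint ℂ :=
  if AnalyticAt ℂ (jacobiSnFun k) z then ((jacobiSnFun k z : ℂ) : OnePoint ℂ) else OnePoint.infty

/-! ### Polynomials of degree one in four variables, on `ℂ ∪ {∞}` -/

/-- Homogeneous coordinates of a point of `ℂ ∪ {∞}`: `[z : 1]` for `z ∈ ℂ`, and `∞ = [1 : 0]`. -/
def homCoord : OnePoint ℂ → ℂ × ℂ
  | none => (1, 0)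
  | some z => (z, 1)

/-- A polynomial of degree one in each of four variables, given in homogenised form, i.e. as a form
which is linear in each of four pairs of homogeneous coordinates. -/
abbrev QuadForm : Type := ℂ × ℂ → ℂ × ℂ → ℂ × ℂ → ℂ × ℂ → ℂ

/-- The equation `P(x₁, x₂, x₃, x₄) = 0` for points of `ℂ ∪ {∞}`. -/
def QuadForm.Vanishes (P : QuadForm) (x₁ x₂ x₃ x₄ : OnePoint ℂ) : Prop :=
  P (homCoord x₁) (homCoord x₂) (homCoord x₃) (homCoord x₄) = 0

/-- The polynomial `H = (∂₃B)(∂₄B) - (∂₃∂₄B) B` in the first two variables. If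
`B(u, u', v, v') = a₀ + a₁ v + a₂ v' + a₃ v v'` with `aᵢ` depending on `u, u'`, then
`H = a₁ a₂ - a₀ a₃`. It is evaluated on homogeneous coordinates of `u, u' ∈ ℂ ∪ {∞}`. -/
def QuadForm.biquadratic (B : QuadForm) (u u' : OnePoint ℂ) : ℂ :=
  let R : ℂ × ℂ → ℂ × ℂ → ℂ := B (homCoord u) (homCoord u')
  let a₀ := R (0, 1) (0, 1)
  let a₁ := R (1, 0) (0, 1)
  let a₂ := R (0, 1) (1, 0)
  let a₃ := R (1, 0) (1, 0)
  a₁ * a₂ - a₀ * a₃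

/-! ### Three-dimensional systems and the Schwarzian variable -/

/-- Functions on the lattice `ℤ³`; the shifts `~`, `^`, `¯` increment the first, second and third
argument respectively. -/
abbrev LatticeFun (X : Type) : Type := ℤ → ℤ → ℤ → X

/-- The polynomials `B₁, B₂, B₃` of a three-dimensional Bäcklund transformation, and
`P₁₂, P₂₃, P₃₁` of the system satisfied by `u`. -/
structure BacklundSystem3D where
  (B₁ B₂ B₃ P₁₂ P₂₃ P₃₁ : QuadForm)

/-- `u` satisfies the three lattice equations
`P₁₂(u, ũ, û, û~) = 0`, `P₂₃(u, û, ū, ū^) = 0`, `P₃₁(u, ū, ũ, ū~) = 0`. -/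
def BacklundSystem3D.IsSolution (S : BacklundSystem3D) (u : LatticeFun (OnePoint ℂ)) : Prop :=
  ∀ n m l : ℤ,
    S.P₁₂.Vanishes (u n m l) (u (n + 1) m l) (u n (m + 1) l) (u (n + 1) (m + 1) l) ∧
    S.P₂₃.Vanishes (u n m l) (u n (m + 1) l) (u n m (l + 1)) (u n (m + 1) (l + 1)) ∧
    S.P₃₁.Vanishes (u n m l) (u n m (l + 1)) (u (n + 1) m l) (u (n + 1) m (l + 1))

/-- `u` is non-singular: `H₁(u, ũ) ≠ 0`, `H₂(u, û) ≠ 0`, `H₃(u, ū) ≠ 0` throughout `ℤ³`. -/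
def BacklundSystem3D.IsNonsingular (S : BacklundSystem3D) (u : LatticeFun (OnePoint ℂ)) : Prop :=
  ∀ n m l : ℤ,
    S.B₁.biquadratic (u n m l) (u (n + 1) m l) ≠ 0 ∧
    S.B₂.biquadratic (u n m l) (u n (m + 1) l) ≠ 0 ∧
    S.B₃.biquadratic (u n m l) (u n m (l + 1)) ≠ 0

/-- The group of Möbius transformations `x ↦ (a x + b) / (c x + d)`, `ad ≠ bc`, of `ℂ ∪ {∞}`. -/
noncomputable def MobiusGroup : Subgroup (Equiv.Perm (OnePoint ℂ)) :=
  (MulAction.toPermHom (Matrix.GeneralLinearGroup (Fin 2) ℂ) (OnePoint ℂ)).range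

/-- `r` is the Möbius transformation `v ↦ v'` defined by the Riccati equation
`B(u, u', v, v') = 0`. -/
def QuadForm.IsRiccatiMap (B : QuadForm) (u u' : OnePoint ℂ) (r : MobiusGroup) : Prop :=
  ∀ v v' : OnePoint ℂ, B.Vanishes u u' v v' ↔ v' = r.1 v

/-- `s : ℤ³ → M` satisfies the Bäcklund system `s~ = r₁ · s`, `s^ = r₂ · s`, `s¯ = r₃ · s`, in
which `r₁`, `r₂`, `r₃` are the Möbius transformations `v ↦ v~`, `v ↦ v^`, `v ↦ v¯` defined by the
Riccati equations with polynomials `B₁`, `B₂`, `B₃`. -/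
def BacklundSystem3D.IsBacklundSolution (S : BacklundSystem3D) (u : LatticeFun (OnePoint ℂ))
    (s : LatticeFun MobiusGroup) : Prop :=
  ∃ r₁ r₂ r₃ : LatticeFun MobiusGroup, ∀ n m l : ℤ,
    (S.B₁.IsRiccatiMap (u n m l) (u (n + 1) m l) (r₁ n m l) ∧
      s (n + 1) m l = r₁ n m l * s n m l) ∧
    (S.B₂.IsRiccatiMap (u n m l) (u n (m + 1) l) (r₂ n m l) ∧
      s n (m + 1) l = r₂ n m l * s n m l) ∧
    (S.B₃.IsRiccatiMap (u n m l) (u n m (l + 1)) (r₃ n m l) ∧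
      s n m (l + 1) = r₃ n m l * s n m l)

/-- `φ` is the Schwarzian variable associated to `u`, for the fixed function `w`:
`φ = s⁻¹(w)` for some solution `s` of the Bäcklund system. -/
def BacklundSystem3D.IsSchwarzianVariable (S : BacklundSystem3D)
    (w u φ : LatticeFun (OnePoint ℂ)) : Prop :=
  ∃ s : LatticeFun MobiusGroup, S.IsBacklundSolution u s ∧
    ∀ n m l : ℤ, φ n m l = ((s n m l)⁻¹).1 (w n m l)

/-! ### The Q4 system -/

/-- The Q4 polynomial `Q_{α,β}` in its Jacobi parametrisation, homogenised; `x₁ x₂ + x₃ x₄`, for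
instance, becomes `X₁ X₂ Y₃ Y₄ + Y₁ Y₂ X₃ X₄` for `xᵢ = [Xᵢ : Yᵢ]`. See `q4Form_coe`. -/
noncomputable def q4Form (k α β : ℂ) : QuadForm := fun x₁ x₂ x₃ x₄ =>
  jacobiSnFun k α * (x₁.1 * x₂.1 * x₃.2 * x₄.2 + x₁.2 * x₂.2 * x₃.1 * x₄.1)
  - jacobiSnFun k β * (x₁.1 * x₃.1 * x₂.2 * x₄.2 + x₁.2 * x₃.2 * x₂.1 * x₄.1)
  - jacobiSnFun k (α - β) *
      (x₁.1 * x₄.1 * x₂.2 * x₃.2 + x₁.2 * x₄.2 * x₂.1 * x₃.1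
        - k * jacobiSnFun k α * jacobiSnFun k β *
          (x₁.2 * x₂.2 * x₃.2 * x₄.2 + x₁.1 * x₂.1 * x₃.1 * x₄.1))

/-- At finite arguments `q4Form` is the polynomial `Q_{α,β}`. -/
theorem q4Form_coe (k α β x₁ x₂ x₃ x₄ : ℂ) :
    q4Form k α β (homCoord x₁) (homCoord x₂) (homCoord x₃) (homCoord x₄) =
      jacobiSnFun k α * (x₁ * x₂ + x₃ * x₄) - jacobiSnFun k β * (x₁ * x₃ + x₂ * x₄)
      - jacobiSnFun k (α - β) * (x₁ * x₄ + x₂ * x₃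
          - k * jacobiSnFun k α * jacobiSnFun k β * (1 + x₁ * x₂ * x₃ * x₄)) := by
  have h : ∀ z : ℂ, homCoord (z : OnePoint ℂ) = (z, 1) := fun _ => rfl
  simp only [q4Form, h]
  ring

/-- The coefficients of `Q_{α,β}` are finite: none of `α`, `β`, `α - β` is a pole of `sn`. -/
def Q4Finite (k α β : ℂ) : Prop :=
  jacobiSn k α ≠ OnePoint.infty ∧ jacobiSn k β ≠ OnePoint.infty ∧
    jacobiSn k (α - β) ≠ OnePoint.infty

/-- The three-dimensional Q4 system. -/
noncomputable def q4System (k α β γ κ : ℂ) : BacklundSystem3D where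
  B₁ := q4Form k α κ
  B₂ := q4Form k β κ
  B₃ := q4Form k γ κ
  P₁₂ := q4Form k α β
  P₂₃ := q4Form k β γ
  P₃₁ := q4Form k γ α

/-- The fixed function `w = √k sn(ζ)`, `ζ = ζ₀ + n α + m β + l γ`, where `ρ = √k`. -/
noncomputable def q4SingularSolution (k ρ α β γ ζ₀ : ℂ) : LatticeFun (OnePoint ℂ) := fun n m l =>
  OnePoint.map (fun x : ℂ => ρ * x) (jacobiSn k (ζ₀ + n * α + m * β + l * γ))

/-! ### The lattice Schwarzian KP equation -/

/-- The difference `a - b` of two points of `ℂ ∪ {∞}` in homogeneous coordinates. It vanishes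
if and only if `a = b`. -/
def homDiff (a b : OnePoint ℂ) : ℂ :=
  (homCoord a).1 * (homCoord b).2 - (homCoord b).1 * (homCoord a).2

/-- The numerator `(φ^ - φ~^)(φ¯ - φ¯^)(φ~ - φ~¯)`. -/
def skpNum (φ : LatticeFun (OnePoint ℂ)) (n m l : ℤ) : ℂ :=
  homDiff (φ n (m + 1) l) (φ (n + 1) (m + 1) l) *
    homDiff (φ n m (l + 1)) (φ n (m + 1) (l + 1)) *
    homDiff (φ (n + 1) m l) (φ (n + 1) m (l + 1))

/-- The denominator `(φ~ - φ~^)(φ^ - φ¯^)(φ¯ - φ~¯)`. -/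
def skpDen (φ : LatticeFun (OnePoint ℂ)) (n m l : ℤ) : ℂ :=
  homDiff (φ (n + 1) m l) (φ (n + 1) (m + 1) l) *
    homDiff (φ n (m + 1) l) (φ n (m + 1) (l + 1)) *
    homDiff (φ n m (l + 1)) (φ (n + 1) m (l + 1))

/-- `φ : ℤ³ → ℂ ∪ {∞}` satisfies the lattice Schwarzian KP equation: numerator and denominator
agree, and their quotient is `1` wherever the denominator does not vanish. Both products have
degree one in each of the same six values of `φ`, so that neither the equation nor the quotient
depends on the choice of homogeneous coordinates. -/
def SatisfiesLatticeSKP (φ : LatticeFun (OnePoint ℂ)) : Prop :=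
  ∀ n m l : ℤ, skpNum φ n m l = skpDen φ n m l ∧
    (skpDen φ n m l ≠ 0 → skpNum φ n m l / skpDen φ n m l = 1)

/-!
Write `K_α(x; X, Y) = Q_{α,κ}(X, Y, √k sn x, √k sn (x + α))`. The Riccati map of an edge `u, u'` with
parameter `α` is induced by a linear map `R` of `ℂ²` with `Q_{α,κ}(u, u', v, v') = ω(R v, v')`, where
`ω` is the symplectic form (`wedge`) whose values at homogeneous coordinates are the differences in
the Schwarzian KP equation. Both sides of that equation have degree one in the same six values of
`φ`, so `φ` may be replaced by its images under the Möbius transformation `s` at the base vertex of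
a cube (`exists_homDiff_eq`). Applying the Riccati maps along two edges then turns the difference
of two values of `φ` at the ends of an edge into the number `K_α(x; u, u')`, up to factors
belonging to single vertices, and up to factors caused by the fact that the linear maps `R`, unlike
the Möbius transformations, commute around a face only up to a scalar (`exists_wedge_eq`).

That scalar is `sn α h_β(u, û) / (sn β h_α(u, ũ))`, where `h` is the biquadratic of the edge
(`riccati_compat`), and its product over the three faces at the base vertex is `1`. This is a
polynomial identity modulo the equation `P₁₂ = 0` and the relations between the values of `sn` at
the differences of the four points `0`, `α`, `β`, `κ`. If one of `sn α`, `sn β`, `sn γ`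
vanishes then so do the others, and both sides of the Schwarzian KP equation are `0`.

It remains to compare the products of the numbers `K` (`q4Form_snPoint_cyclic`). Since `√k sn` is the
singular solution of Q4, `K_α(x; X, Y)` is a product of `sn α · N_α(x)`, a polynomial in `X` with zero
`√k sn (x + κ)`, and a polynomial in `Y` with zero `√k sn (x + α - κ)`
(`IsSnRadius.q4Form_singular`). The logarithmic derivative of `N_α` in `x` is a
difference of values of one function at `x + α` and at `x`, so that `N_α(x)` splits as
`c(α) F(x) G(x + α)` (`IsSnRadius.exists_q4Factor_eq`). Hence `K_α(x; X, Y)` is a product of terms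
depending on `α`, on `(x, X)` and on `(x + α, Y)`, and the same terms occur on both sides.

All identities between values of `sn` are first proved for small arguments, where `sn` has no poles
and the denominators in its addition theorem do not vanish. They are extended to all arguments by the
identity theorem, in the variable `t`, for meromorphic functions built from the functions `sn (t z)`
(`eventually_eq_of_eventuallyEq_zero`).
-/

/-! ### Symmetries of `sn` -/

theorem meromorphicAt_jacobiSnFun (k z : ℂ) : MeromorphicAt (jacobiSnFun k) z :=
  ((jacobiSnFun_spec k).meromorphicNFAt z).meromorphicAt

theorem jacobiSnFun_zero (k : ℂ) : jacobiSnFun k 0 = 0 := (jacobiSnFun_spec k).map_zero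

theorem jacobiSn_ne_infty_iff {k z : ℂ} :
    jacobiSn k z ≠ OnePoint.infty ↔ AnalyticAt ℂ (jacobiSnFun k) z := by
  unfold jacobiSn
  split_ifs with h <;> simp [h]

/-- If `sn p = 0`, then `x ↦ c sn (e x + p)` with signs `c`, `e` solves the initial value problem
that characterises `sn`, provided that its derivative at `0` is `1`. -/
theorem mul_jacobiSnFun_affine {k p c e : ℂ} (hp : AnalyticAt ℂ (jacobiSnFun k) p)
    (h0 : jacobiSnFun k p = 0) (hc : c ^ 2 = 1) (he : e ^ 2 = 1)
    (hd : c * (deriv (jacobiSnFun k) p * e) = 1) (x : ℂ) :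
    c * jacobiSnFun k (e * x + p) = jacobiSnFun k x := by
  have hf := jacobiSnFun_spec k
  have hc0 : c ≠ 0 := by rintro rfl; norm_num at hc
  have he0 : e ≠ 0 := by rintro rfl; norm_num at he
  have hlin : ∀ z, HasDerivAt (fun x : ℂ => e * x + p) e z := fun z => by
    simpa using ((hasDerivAt_id z).const_mul e).add_const p
  have hder : ∀ z, AnalyticAt ℂ (jacobiSnFun k) (e * z + p) →
      HasDerivAt (fun x => c * jacobiSnFun k (e * x + p))
        (c * (deriv (jacobiSnFun k) (e * z + p) * e)) z := fun z hz =>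
    (HasDerivAt.comp (h₂ := jacobiSnFun k) z hz.differentiableAt.hasDerivAt (hlin z)).const_mul c
  have hnf : ∀ z, MeromorphicNFAt (fun x => c * jacobiSnFun k (e * x + p)) z := fun z =>
    ((hf.meromorphicNFAt (e * z + p)).comp_analyticAt
      (g := fun x => e * x + p) (by fun_prop)).smul_analytic (g := fun _ => c) (by fun_prop) hc0
  have hp' : AnalyticAt ℂ (jacobiSnFun k) (e * 0 + p) := by simpa using hp
  refine congrFun (IsJacobiSn.unique (k := k) (f := fun x => c * jacobiSnFun k (e * x + p))
    ⟨hnf, ?_, by simp [h0], ?_, ?_⟩ hf) x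
  · have h1 : AnalyticAt ℂ (fun x : ℂ => e * x + p) 0 := by fun_prop
    exact analyticAt_const.mul (AnalyticAt.fun_comp (f := fun x : ℂ => e * x + p) hp' h1)
  · rw [(hder 0 hp').deriv]
    simpa using hd
  · intro z hz
    have hz' : AnalyticAt ℂ (jacobiSnFun k) (e * z + p) := by
      have h1 : AnalyticAt ℂ (fun y : ℂ => e⁻¹ * (y - p)) (e * z + p) := by fun_prop
      have h2 : e⁻¹ * (e * z + p - p) = z := by field_simp; ring
      rw [← h2] at hz
      have h3 := (analyticAt_const (v := c⁻¹)).mul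
        (AnalyticAt.fun_comp (f := fun y : ℂ => e⁻¹ * (y - p)) hz h1)
      refine h3.congr (Eventually.of_forall fun y => ?_)
      have : e * (e⁻¹ * (y - p)) + p = y := by field_simp; ring
      simp [this, hc0]
    rw [(hder z hz').deriv]
    have := hf.ode _ hz'
    linear_combination (c ^ 2 * e ^ 2) * this
      + (c ^ 2 * (1 - jacobiSnFun k (e * z + p) ^ 2)
        * (1 - k ^ 2 * jacobiSnFun k (e * z + p) ^ 2)) * he
      + (1 - k ^ 2 * jacobiSnFun k (e * z + p) ^ 4 * c ^ 2) * hc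

theorem jacobiSnFun_neg (k x : ℂ) : jacobiSnFun k (-x) = -jacobiSnFun k x := by
  have hf := jacobiSnFun_spec k
  have := mul_jacobiSnFun_affine (c := -1) (e := -1) hf.analyticAt_zero hf.map_zero
    (by norm_num) (by norm_num) (by simp [hf.deriv_zero]) x
  simp only [neg_mul, one_mul, add_zero] at this
  linear_combination -this

theorem deriv_jacobiSnFun_neg (k x : ℂ) :
    deriv (jacobiSnFun k) (-x) = deriv (jacobiSnFun k) x := by
  have h1 : (fun y => jacobiSnFun k (-y)) = fun y => -jacobiSnFun k y :=
    funext (jacobiSnFun_neg k)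
  have h2 := congrArg (fun g => deriv g x) h1
  simp only [deriv.fun_neg, deriv_comp_neg (f := jacobiSnFun k)] at h2
  linear_combination -h2

/-- Translation by a zero of `sn` multiplies `sn` by a sign. -/
theorem exists_jacobiSnFun_add_zero {k p : ℂ} (hp : AnalyticAt ℂ (jacobiSnFun k) p)
    (h0 : jacobiSnFun k p = 0) :
    ∃ ε : ℂ, ε ^ 2 = 1 ∧ ∀ x, jacobiSnFun k (x + p) = ε * jacobiSnFun k x := by
  have hε : deriv (jacobiSnFun k) p ^ 2 = 1 := by
    rw [(jacobiSnFun_spec k).ode p hp, h0]; ring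
  refine ⟨deriv (jacobiSnFun k) p, hε, fun x => ?_⟩
  have := mul_jacobiSnFun_affine (e := 1) hp h0 hε (by norm_num) (by linear_combination hε) x
  rw [one_mul] at this
  linear_combination deriv (jacobiSnFun k) p * this - jacobiSnFun k (x + p) * hε

theorem jacobiSnFun_modulus_zero : jacobiSnFun 0 = Complex.sin := by
  refine (jacobiSnFun_spec 0).unique ⟨fun z => ?_, ?_, by simp, by simp, fun z _ => ?_⟩
  · exact (Complex.analyticAt_sin).meromorphicNFAt
  · exact Complex.analyticAt_sin
  · rw [Complex.deriv_sin]
    linear_combination Complex.sin_sq_add_cos_sq z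

/-! ### The addition theorem near the origin -/

/-- A radius `r` such that, on the disk `‖z‖ < r`, the function `sn` satisfies its differential
equations, has no zero but `0`, and is so small that the denominators `1 - k² sn² x sn² y` of the
addition theorem do not vanish. -/
structure IsSnRadius (k : ℂ) (r : ℝ) : Prop where
  pos : 0 < r
  analyticAt : ∀ z, ‖z‖ < r → AnalyticAt ℂ (jacobiSnFun k) z
  ode2 : ∀ z, ‖z‖ < r → deriv (deriv (jacobiSnFun k)) z =
    -(1 + k ^ 2) * jacobiSnFun k z + 2 * k ^ 2 * jacobiSnFun k z ^ 3
  small : ∀ z, ‖z‖ < r → ‖k * jacobiSnFun k z ^ 2‖ < 1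
  ne_zero : ∀ z, ‖z‖ < r → z ≠ 0 → jacobiSnFun k z ≠ 0

theorem exists_isSnRadius (k : ℂ) : ∃ r, IsSnRadius k r := by
  have hf := jacobiSnFun_spec k
  have hl : IsLocalSn k (jacobiSnFun k) :=
    ⟨hf.analyticAt_zero, hf.map_zero, hf.deriv_zero,
      hf.analyticAt_zero.eventually_analyticAt.mono hf.ode⟩
  have hc := hf.analyticAt_zero.continuousAt
  have h1 : ∀ᶠ z in 𝓝 0, ‖k * jacobiSnFun k z ^ 2‖ < 1 := by
    have h2 : ContinuousAt (fun z => ‖k * jacobiSnFun k z ^ 2‖) 0 := by fun_prop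
    exact h2.eventually_lt continuousAt_const (by simp [hf.map_zero])
  have h3 : ∀ᶠ z in 𝓝 0, z ≠ 0 → jacobiSnFun k z ≠ 0 := by
    have h4 := hf.analyticAt_zero.differentiableAt.hasDerivAt.eventually_ne
      (c := 0) (by simp [hf.deriv_zero])
    exact eventually_nhdsWithin_iff.1 h4
  obtain ⟨r, hr, h⟩ := Metric.eventually_nhds_iff_ball.1
    (hf.analyticAt_zero.eventually_analyticAt.and (hl.ode2.and (h1.and h3)))
  simp only [mem_ball_zero_iff] at h
  exact ⟨r, hr, fun z hz => (h z hz).1, fun z hz => (h z hz).2.1, fun z hz => (h z hz).2.2.1,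
    fun z hz => (h z hz).2.2.2⟩

theorem IsSnRadius.denom_ne_zero {k : ℂ} {r : ℝ} (hr : IsSnRadius k r) {x y : ℂ}
    (hx : ‖x‖ < r) (hy : ‖y‖ < r) :
    1 - k ^ 2 * jacobiSnFun k x ^ 2 * jacobiSnFun k y ^ 2 ≠ 0 := by
  intro h
  have h1 : (k * jacobiSnFun k x ^ 2) * (k * jacobiSnFun k y ^ 2) = 1 := by
    linear_combination -h
  have h2 := congrArg norm h1
  rw [norm_mul, norm_one] at h2
  nlinarith [hr.small x hx, hr.small y hy, norm_nonneg (k * jacobiSnFun k x ^ 2),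
    norm_nonneg (k * jacobiSnFun k y ^ 2)]

/-- The addition theorem. For fixed `s`, the right-hand side divided by the denominator has
derivative `0` as a function of `x`, where `y = s - x`. -/
theorem IsSnRadius.add {k : ℂ} {r : ℝ} (hr : IsSnRadius k r) {x y : ℂ} (hx : ‖x‖ < r)
    (hy : ‖y‖ < r) (hxy : ‖x + y‖ < r) :
    jacobiSnFun k (x + y) * (1 - k ^ 2 * jacobiSnFun k x ^ 2 * jacobiSnFun k y ^ 2) =
      jacobiSnFun k x * deriv (jacobiSnFun k) y + deriv (jacobiSnFun k) x * jacobiSnFun k y := by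
  have hf := jacobiSnFun_spec k
  obtain ⟨s, rfl⟩ : ∃ s, y = s - x := ⟨x + y, by ring⟩
  rw [add_sub_cancel] at hxy ⊢
  set f := jacobiSnFun k with hfdef
  let G : ℂ → ℂ := fun z => (f z * deriv f (s - z) + deriv f z * f (s - z)) /
    (1 - k ^ 2 * f z ^ 2 * f (s - z) ^ 2)
  have hG : ∀ z ∈ Metric.ball (0 : ℂ) r ∩ Metric.ball s r, HasDerivAt G 0 z := by
    rintro z ⟨hz, hzs⟩
    rw [mem_ball_zero_iff] at hz
    rw [Metric.mem_ball, dist_comm, dist_eq_norm] at hzs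
    have a1 := (hr.analyticAt z hz)
    have a2 := (hr.analyticAt _ hzs)
    have hs : HasDerivAt (fun z : ℂ => s - z) (-1) z := (hasDerivAt_id z).const_sub s
    have d1 : HasDerivAt f (deriv f z) z := a1.differentiableAt.hasDerivAt
    have d2 : HasDerivAt (deriv f) (deriv (deriv f) z) z := a1.deriv.differentiableAt.hasDerivAt
    have d3 : HasDerivAt (fun z => f (s - z)) (deriv f (s - z) * -1) z :=
      HasDerivAt.comp (h₂ := f) z a2.differentiableAt.hasDerivAt hs
    have d4 : HasDerivAt (fun z => deriv f (s - z)) (deriv (deriv f) (s - z) * -1) z :=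
      HasDerivAt.comp (h₂ := deriv f) z a2.deriv.differentiableAt.hasDerivAt hs
    have hne := hr.denom_ne_zero hz hzs
    have d5 := ((d1.mul d4).add (d2.mul d3)).div
      ((((d1.pow 2).const_mul (k ^ 2)).mul (d3.pow 2)).const_sub 1) hne
    refine d5.congr_deriv ?_
    rw [div_eq_zero_iff]
    left
    have o1 := hf.ode z a1
    have o2 := hf.ode _ a2
    have e1 := hr.ode2 z hz
    have e2 := hr.ode2 _ hzs
    rw [← hfdef] at e1 e2
    simp only [Pi.add_apply, Pi.mul_apply, Pi.pow_apply, Nat.cast_ofNat, Nat.add_one_sub_one, pow_one]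
    rw [e1, e2]
    generalize f z = p at *
    generalize f (s - z) = q at *
    generalize deriv f z = p' at *
    generalize deriv f (s - z) = q' at *
    linear_combination (2 * k ^ 2 * p * q ^ 3) * o1 - (2 * k ^ 2 * p ^ 3 * q) * o2
  have hmem : ∀ z, ‖z‖ < r → ‖s - z‖ < r → z ∈ Metric.ball (0 : ℂ) r ∩ Metric.ball s r := by
    intro z h1 h2
    rw [Set.mem_inter_iff, mem_ball_zero_iff, Metric.mem_ball, dist_comm, dist_eq_norm]
    exact ⟨h1, h2⟩
  have hconst := (Metric.isOpen_ball.inter Metric.isOpen_ball).is_const_of_deriv_eq_zero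
    ((convex_ball (0 : ℂ) r).inter (convex_ball s r)).isPreconnected
    (fun z hz => (hG z hz).differentiableAt.differentiableWithinAt)
    (fun z hz => (hG z hz).deriv) (hmem x hx hy) (hmem 0 (by simpa using hr.pos) (by simpa))
  simp only [G, sub_zero] at hconst
  rw [hf.map_zero, hf.deriv_zero, div_eq_iff (hr.denom_ne_zero hx hy)] at hconst
  linear_combination -hconst

theorem IsSnRadius.sub {k : ℂ} {r : ℝ} (hr : IsSnRadius k r) {x y : ℂ} (hx : ‖x‖ < r)
    (hy : ‖y‖ < r) (hxy : ‖x - y‖ < r) :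
    jacobiSnFun k (x - y) * (1 - k ^ 2 * jacobiSnFun k x ^ 2 * jacobiSnFun k y ^ 2) =
      jacobiSnFun k x * deriv (jacobiSnFun k) y - deriv (jacobiSnFun k) x * jacobiSnFun k y := by
  have := hr.add hx (y := -y) (by simpa using hy) (by simpa [← sub_eq_add_neg] using hxy)
  rw [← sub_eq_add_neg, jacobiSnFun_neg, deriv_jacobiSnFun_neg] at this
  linear_combination this

/-! ### Analytic continuation along rays -/

/-- An identity between meromorphic functions that holds near `0` holds near `1`. It is applied
to functions of `t` built from the values `sn (t z)`: this extends identities from small to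
arbitrary arguments. -/
theorem eventually_eq_of_eventuallyEq_zero {F G : ℂ → ℂ} (hF : ∀ t, MeromorphicAt F t)
    (hG : ∀ t, MeromorphicAt G t) (h : F =ᶠ[𝓝 0] G) : F =ᶠ[𝓝[≠] 1] G := by
  have h1 : MeromorphicOn (F - G) (Metric.ball 0 2) := fun t _ => (hF t).sub (hG t)
  have h2 : ∀ᶠ t in 𝓝 0, (F - G) t = 0 := by
    filter_upwards [h] with t ht
    simp [ht]
  filter_upwards [h1.eventually_eq_zero_of_ball h2 (z := 1) (by simp)] with t ht
  exact sub_eq_zero.1 ht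

theorem eq_at_one_of_eventuallyEq_zero {F G : ℂ → ℂ} (hF : ∀ t, MeromorphicAt F t)
    (hG : ∀ t, MeromorphicAt G t) (h : F =ᶠ[𝓝 0] G) (cF : ContinuousAt F 1)
    (cG : ContinuousAt G 1) : F 1 = G 1 :=
  tendsto_nhds_unique_of_eventuallyEq (cF.mono_left nhdsWithin_le_nhds)
    (cG.mono_left nhdsWithin_le_nhds) (eventually_eq_of_eventuallyEq_zero hF hG h)

theorem meromorphicAt_comp_mul {g : ℂ → ℂ} (hg : ∀ z, MeromorphicAt g z) (z t : ℂ) :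
    MeromorphicAt (fun t => g (t * z)) t :=
  (hg (t * z)).comp_analyticAt (g := fun t : ℂ => t * z) (by fun_prop)

theorem continuousAt_comp_mul {g : ℂ → ℂ} {z : ℂ} (hg : ContinuousAt g z) :
    ContinuousAt (fun t : ℂ => g (t * z)) 1 :=
  ContinuousAt.comp (g := g) (f := fun t : ℂ => t * z) (by simpa using hg) (by fun_prop)

theorem eventually_norm_mul_lt (z : ℂ) {r : ℝ} (hr : 0 < r) : ∀ᶠ t : ℂ in 𝓝 0, ‖t * z‖ < r := by
  have : ContinuousAt (fun t : ℂ => ‖t * z‖) 0 := by fun_prop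
  exact this.eventually_lt continuousAt_const (by simpa using hr)

/-! ### Relations between the values of `sn` at differences of points -/

theorem IsSnRadius.ptolemy {k : ℂ} {r : ℝ} (hr : IsSnRadius k r) {α β κ : ℂ} (hα : ‖α‖ < r)
    (hβ : ‖β‖ < r) (hκ : ‖κ‖ < r) (hαβ : ‖α - β‖ < r) (hακ : ‖α - κ‖ < r) (hβκ : ‖β - κ‖ < r) :
    jacobiSnFun k β * jacobiSnFun k (α - κ) - jacobiSnFun k α * jacobiSnFun k (β - κ) =
      jacobiSnFun k κ * jacobiSnFun k (α - β) * (1 - k ^ 2 * (jacobiSnFun k α * jacobiSnFun k β *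
        jacobiSnFun k (α - κ) * jacobiSnFun k (β - κ))) := by
  have hf := jacobiSnFun_spec k
  have hA := hf.ode α (hr.analyticAt α hα)
  have hB := hf.ode β (hr.analyticAt β hβ)
  have hC := hf.ode κ (hr.analyticAt κ hκ)
  have hd := hr.sub hα hβ hαβ
  have he := hr.sub hα hκ hακ
  have hg := hr.sub hβ hκ hβκ
  have h1 := hr.denom_ne_zero hα hβ
  have h2 := hr.denom_ne_zero hα hκ
  have h3 := hr.denom_ne_zero hβ hκ
  apply mul_left_cancel₀ (mul_ne_zero (mul_ne_zero h1 h2) h3)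
  generalize jacobiSnFun k (α - β) = d at *
  generalize jacobiSnFun k (α - κ) = e at *
  generalize jacobiSnFun k (β - κ) = g at *
  generalize jacobiSnFun k α = a at *
  generalize jacobiSnFun k β = b at *
  generalize jacobiSnFun k κ = c at *
  generalize deriv (jacobiSnFun k) α = A at *
  generalize deriv (jacobiSnFun k) β = B at *
  generalize deriv (jacobiSnFun k) κ = C at *
  linear_combination
    (b * (1 - k ^ 2 * a ^ 2 * b ^ 2) * (1 - k ^ 2 * b ^ 2 * c ^ 2)) * he
    - (a * (1 - k ^ 2 * a ^ 2 * b ^ 2) * (1 - k ^ 2 * a ^ 2 * c ^ 2)) * hg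
    - (c * (1 - k ^ 2 * a ^ 2 * c ^ 2) * (1 - k ^ 2 * b ^ 2 * c ^ 2)) * hd
    + (k ^ 2 * a * b * c) *
      ((e * (1 - k ^ 2 * a ^ 2 * c ^ 2) * (g * (1 - k ^ 2 * b ^ 2 * c ^ 2))) * hd
        + ((a * B - A * b) * (g * (1 - k ^ 2 * b ^ 2 * c ^ 2))) * he
        + ((a * B - A * b) * (a * C - A * c)) * hg
        + (a * b * (a * B - b * A)) * hC - (a ^ 2 * c * C - a * c ^ 2 * A) * hB
        + (b ^ 2 * c * C - b * c ^ 2 * B) * hA)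

theorem IsSnRadius.ptolemy' {k : ℂ} {r : ℝ} (hr : IsSnRadius k r) {α β κ : ℂ} (hα : ‖α‖ < r)
    (hβ : ‖β‖ < r) (hκ : ‖κ‖ < r) (hαβ : ‖α - β‖ < r) (hακ : ‖α - κ‖ < r) (hβκ : ‖β - κ‖ < r) :
    jacobiSnFun k κ * (jacobiSnFun k α * jacobiSnFun k (α - κ)
        - jacobiSnFun k β * jacobiSnFun k (β - κ)) =
      jacobiSnFun k (α - β) * (jacobiSnFun k α * jacobiSnFun k β
        - jacobiSnFun k (α - κ) * jacobiSnFun k (β - κ)) := by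
  have hf := jacobiSnFun_spec k
  have hA := hf.ode α (hr.analyticAt α hα)
  have hB := hf.ode β (hr.analyticAt β hβ)
  have hC := hf.ode κ (hr.analyticAt κ hκ)
  have hd := hr.sub hα hβ hαβ
  have he := hr.sub hα hκ hακ
  have hg := hr.sub hβ hκ hβκ
  have h1 := hr.denom_ne_zero hα hβ
  have h2 := hr.denom_ne_zero hα hκ
  have h3 := hr.denom_ne_zero hβ hκ
  apply mul_left_cancel₀ (mul_ne_zero (mul_ne_zero h1 h2) h3)
  generalize jacobiSnFun k (α - β) = d at *
  generalize jacobiSnFun k (α - κ) = e at *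
  generalize jacobiSnFun k (β - κ) = g at *
  generalize jacobiSnFun k α = a at *
  generalize jacobiSnFun k β = b at *
  generalize jacobiSnFun k κ = c at *
  generalize deriv (jacobiSnFun k) α = A at *
  generalize deriv (jacobiSnFun k) β = B at *
  generalize deriv (jacobiSnFun k) κ = C at *
  linear_combination
    (c * a * (1 - k ^ 2 * a ^ 2 * b ^ 2) * (1 - k ^ 2 * b ^ 2 * c ^ 2)) * he
    - (c * b * (1 - k ^ 2 * a ^ 2 * b ^ 2) * (1 - k ^ 2 * a ^ 2 * c ^ 2)) * hg
    - (a * b * (1 - k ^ 2 * a ^ 2 * c ^ 2) * (1 - k ^ 2 * b ^ 2 * c ^ 2)) * hd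
    + ((e * (1 - k ^ 2 * a ^ 2 * c ^ 2) * (g * (1 - k ^ 2 * b ^ 2 * c ^ 2))) * hd
        + ((a * B - A * b) * (g * (1 - k ^ 2 * b ^ 2 * c ^ 2))) * he
        + ((a * B - A * b) * (a * C - A * c)) * hg
        + (a * b * (a * B - b * A)) * hC - (a ^ 2 * c * C - a * c ^ 2 * A) * hB
        + (b ^ 2 * c * C - b * c ^ 2 * B) * hA)

theorem IsSnRadius.triangle {k : ℂ} {r : ℝ} (hr : IsSnRadius k r) {α β : ℂ} (hα : ‖α‖ < r)
    (hβ : ‖β‖ < r) (hαβ : ‖α - β‖ < r) :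
    jacobiSnFun k β ^ 2 + jacobiSnFun k (α - β) ^ 2 - jacobiSnFun k α ^ 2
        - k ^ 2 * jacobiSnFun k α ^ 2 * jacobiSnFun k β ^ 2 * jacobiSnFun k (α - β) ^ 2 =
      -(2 * deriv (jacobiSnFun k) α * jacobiSnFun k β * jacobiSnFun k (α - β)) := by
  have hf := jacobiSnFun_spec k
  have hA := hf.ode α (hr.analyticAt α hα)
  have hB := hf.ode β (hr.analyticAt β hβ)
  have hd := hr.sub hα hβ hαβ
  have h1 := hr.denom_ne_zero hα hβ
  apply mul_left_cancel₀ h1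
  generalize jacobiSnFun k (α - β) = d at *
  generalize jacobiSnFun k α = a at *
  generalize jacobiSnFun k β = b at *
  generalize deriv (jacobiSnFun k) α = A at *
  generalize deriv (jacobiSnFun k) β = B at *
  linear_combination (d * (1 - k ^ 2 * a ^ 2 * b ^ 2) + (a * B - A * b) + 2 * A * b) * hd
    + a ^ 2 * hB - b ^ 2 * hA

/-! ### Continuation of the relations -/

section continuation

variable {k : ℂ} {α β κ : ℂ}

theorem jacobiSnFun_sub (hα : AnalyticAt ℂ (jacobiSnFun k) α)
    (hβ : AnalyticAt ℂ (jacobiSnFun k) β) (hαβ : AnalyticAt ℂ (jacobiSnFun k) (α - β)) :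
    jacobiSnFun k (α - β) * (1 - k ^ 2 * jacobiSnFun k α ^ 2 * jacobiSnFun k β ^ 2) =
      jacobiSnFun k α * deriv (jacobiSnFun k) β - deriv (jacobiSnFun k) α * jacobiSnFun k β := by
  obtain ⟨r, hr⟩ := exists_isSnRadius k
  have m := fun z t => meromorphicAt_comp_mul (meromorphicAt_jacobiSnFun k) z t
  have m' := fun z t => meromorphicAt_comp_mul (fun z => (meromorphicAt_jacobiSnFun k z).deriv) z t
  have c1 := continuousAt_comp_mul hα.continuousAt
  have c2 := continuousAt_comp_mul hβ.continuousAt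
  have c3 := continuousAt_comp_mul hαβ.continuousAt
  have c4 := continuousAt_comp_mul hα.deriv.continuousAt
  have c5 := continuousAt_comp_mul hβ.deriv.continuousAt
  have key := eq_at_one_of_eventuallyEq_zero
    (F := fun t => jacobiSnFun k (t * (α - β)) *
      (1 - k ^ 2 * jacobiSnFun k (t * α) ^ 2 * jacobiSnFun k (t * β) ^ 2))
    (G := fun t => jacobiSnFun k (t * α) * deriv (jacobiSnFun k) (t * β)
      - deriv (jacobiSnFun k) (t * α) * jacobiSnFun k (t * β))
    (fun t => by fun_prop) (fun t => by fun_prop) ?_ (by fun_prop) (by fun_prop)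
  · simpa using key
  · filter_upwards [eventually_norm_mul_lt α hr.pos, eventually_norm_mul_lt β hr.pos,
      eventually_norm_mul_lt (α - β) hr.pos] with t h1 h2 h3
    rw [mul_sub] at h3
    simp only [mul_sub t]
    exact hr.sub h1 h2 h3

/-- A relation between the values of `sn` at the three differences of the points `0`, `α`, `β`. -/
theorem jacobiSnFun_triangle (hα : AnalyticAt ℂ (jacobiSnFun k) α)
    (hβ : AnalyticAt ℂ (jacobiSnFun k) β) (hαβ : AnalyticAt ℂ (jacobiSnFun k) (α - β)) :
    jacobiSnFun k β ^ 2 + jacobiSnFun k (α - β) ^ 2 - jacobiSnFun k α ^ 2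
        - k ^ 2 * jacobiSnFun k α ^ 2 * jacobiSnFun k β ^ 2 * jacobiSnFun k (α - β) ^ 2 =
      -(2 * deriv (jacobiSnFun k) α * jacobiSnFun k β * jacobiSnFun k (α - β)) := by
  obtain ⟨r, hr⟩ := exists_isSnRadius k
  have m := fun z t => meromorphicAt_comp_mul (meromorphicAt_jacobiSnFun k) z t
  have m' := fun z t => meromorphicAt_comp_mul (fun z => (meromorphicAt_jacobiSnFun k z).deriv) z t
  have c1 := continuousAt_comp_mul hα.continuousAt
  have c2 := continuousAt_comp_mul hβ.continuousAt
  have c3 := continuousAt_comp_mul hαβ.continuousAt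
  have c4 := continuousAt_comp_mul hα.deriv.continuousAt
  have key := eq_at_one_of_eventuallyEq_zero
    (F := fun t => jacobiSnFun k (t * β) ^ 2 + jacobiSnFun k (t * (α - β)) ^ 2
      - jacobiSnFun k (t * α) ^ 2 - k ^ 2 * jacobiSnFun k (t * α) ^ 2 * jacobiSnFun k (t * β) ^ 2
        * jacobiSnFun k (t * (α - β)) ^ 2)
    (G := fun t => -(2 * deriv (jacobiSnFun k) (t * α) * jacobiSnFun k (t * β)
      * jacobiSnFun k (t * (α - β))))
    (fun t => by fun_prop) (fun t => by fun_prop) ?_ (by fun_prop) (by fun_prop)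
  · simpa using key
  · filter_upwards [eventually_norm_mul_lt α hr.pos, eventually_norm_mul_lt β hr.pos,
      eventually_norm_mul_lt (α - β) hr.pos] with t h1 h2 h3
    rw [mul_sub] at h3 ⊢
    exact hr.triangle h1 h2 h3

/-- A relation between the values of `sn` at the six differences of the points `0`, `α`, `β`, `κ`,
an elliptic form of the Ptolemy theorem. -/
theorem jacobiSnFun_ptolemy (hα : AnalyticAt ℂ (jacobiSnFun k) α)
    (hβ : AnalyticAt ℂ (jacobiSnFun k) β) (hκ : AnalyticAt ℂ (jacobiSnFun k) κ)
    (hαβ : AnalyticAt ℂ (jacobiSnFun k) (α - β)) (hακ : AnalyticAt ℂ (jacobiSnFun k) (α - κ))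
    (hβκ : AnalyticAt ℂ (jacobiSnFun k) (β - κ)) :
    jacobiSnFun k β * jacobiSnFun k (α - κ) - jacobiSnFun k α * jacobiSnFun k (β - κ) =
      jacobiSnFun k κ * jacobiSnFun k (α - β) * (1 - k ^ 2 * (jacobiSnFun k α * jacobiSnFun k β *
        jacobiSnFun k (α - κ) * jacobiSnFun k (β - κ))) := by
  obtain ⟨r, hr⟩ := exists_isSnRadius k
  have m := fun z t => meromorphicAt_comp_mul (meromorphicAt_jacobiSnFun k) z t
  have c1 := continuousAt_comp_mul hα.continuousAt
  have c2 := continuousAt_comp_mul hβ.continuousAt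
  have c3 := continuousAt_comp_mul hκ.continuousAt
  have c4 := continuousAt_comp_mul hαβ.continuousAt
  have c5 := continuousAt_comp_mul hακ.continuousAt
  have c6 := continuousAt_comp_mul hβκ.continuousAt
  have key := eq_at_one_of_eventuallyEq_zero
    (F := fun t => jacobiSnFun k (t * β) * jacobiSnFun k (t * (α - κ))
      - jacobiSnFun k (t * α) * jacobiSnFun k (t * (β - κ)))
    (G := fun t => jacobiSnFun k (t * κ) * jacobiSnFun k (t * (α - β)) *
      (1 - k ^ 2 * (jacobiSnFun k (t * α) * jacobiSnFun k (t * β) *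
        jacobiSnFun k (t * (α - κ)) * jacobiSnFun k (t * (β - κ)))))
    (fun t => by fun_prop) (fun t => by fun_prop) ?_ (by fun_prop) (by fun_prop)
  · simpa using key
  · filter_upwards [eventually_norm_mul_lt α hr.pos, eventually_norm_mul_lt β hr.pos,
      eventually_norm_mul_lt κ hr.pos, eventually_norm_mul_lt (α - β) hr.pos,
      eventually_norm_mul_lt (α - κ) hr.pos, eventually_norm_mul_lt (β - κ) hr.pos]
      with t h1 h2 h3 h4 h5 h6
    rw [mul_sub] at h4 h5 h6
    simp only [mul_sub t]
    exact hr.ptolemy h1 h2 h3 h4 h5 h6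

/-- A second relation between the values of `sn` at the six differences of `0`, `α`, `β`, `κ`. -/
theorem jacobiSnFun_ptolemy' (hα : AnalyticAt ℂ (jacobiSnFun k) α)
    (hβ : AnalyticAt ℂ (jacobiSnFun k) β) (hκ : AnalyticAt ℂ (jacobiSnFun k) κ)
    (hαβ : AnalyticAt ℂ (jacobiSnFun k) (α - β)) (hακ : AnalyticAt ℂ (jacobiSnFun k) (α - κ))
    (hβκ : AnalyticAt ℂ (jacobiSnFun k) (β - κ)) :
    jacobiSnFun k κ * (jacobiSnFun k α * jacobiSnFun k (α - κ)
        - jacobiSnFun k β * jacobiSnFun k (β - κ)) =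
      jacobiSnFun k (α - β) * (jacobiSnFun k α * jacobiSnFun k β
        - jacobiSnFun k (α - κ) * jacobiSnFun k (β - κ)) := by
  obtain ⟨r, hr⟩ := exists_isSnRadius k
  have m := fun z t => meromorphicAt_comp_mul (meromorphicAt_jacobiSnFun k) z t
  have c1 := continuousAt_comp_mul hα.continuousAt
  have c2 := continuousAt_comp_mul hβ.continuousAt
  have c3 := continuousAt_comp_mul hκ.continuousAt
  have c4 := continuousAt_comp_mul hαβ.continuousAt
  have c5 := continuousAt_comp_mul hακ.continuousAt
  have c6 := continuousAt_comp_mul hβκ.continuousAt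
  have key := eq_at_one_of_eventuallyEq_zero
    (F := fun t => jacobiSnFun k (t * κ) * (jacobiSnFun k (t * α) * jacobiSnFun k (t * (α - κ))
        - jacobiSnFun k (t * β) * jacobiSnFun k (t * (β - κ))))
    (G := fun t => jacobiSnFun k (t * (α - β)) * (jacobiSnFun k (t * α) * jacobiSnFun k (t * β)
        - jacobiSnFun k (t * (α - κ)) * jacobiSnFun k (t * (β - κ))))
    (fun t => by fun_prop) (fun t => by fun_prop) ?_ (by fun_prop) (by fun_prop)
  · simpa using key
  · filter_upwards [eventually_norm_mul_lt α hr.pos, eventually_norm_mul_lt β hr.pos,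
      eventually_norm_mul_lt κ hr.pos, eventually_norm_mul_lt (α - β) hr.pos,
      eventually_norm_mul_lt (α - κ) hr.pos, eventually_norm_mul_lt (β - κ) hr.pos]
      with t h1 h2 h3 h4 h5 h6
    rw [mul_sub] at h4 h5 h6
    simp only [mul_sub t]
    exact hr.ptolemy' h1 h2 h3 h4 h5 h6

/-- `sn (α - β) (sn α sn' β + sn' α sn β) = sn² α - sn² β`. -/
theorem jacobiSnFun_sub_mul_add (hα : AnalyticAt ℂ (jacobiSnFun k) α)
    (hβ : AnalyticAt ℂ (jacobiSnFun k) β) (hαβ : AnalyticAt ℂ (jacobiSnFun k) (α - β)) :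
    jacobiSnFun k (α - β) * (jacobiSnFun k α * deriv (jacobiSnFun k) β
        + deriv (jacobiSnFun k) α * jacobiSnFun k β) =
      jacobiSnFun k α ^ 2 - jacobiSnFun k β ^ 2 := by
  linear_combination jacobiSnFun_triangle hα hβ hαβ
    - jacobiSnFun k (α - β) * jacobiSnFun_sub hα hβ hαβ

end continuation

/-! ### The Q4 polynomial at the singular solution -/

/-- Homogeneous coordinates of `ρ sn x`. -/
noncomputable def snPoint (k ρ x : ℂ) : ℂ × ℂ :=
  homCoord (OnePoint.map (fun y : ℂ => ρ * y) (jacobiSn k x))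

theorem snPoint_of_analyticAt {k ρ x : ℂ} (hx : AnalyticAt ℂ (jacobiSnFun k) x) :
    snPoint k ρ x = (ρ * jacobiSnFun k x, 1) := by
  simp only [snPoint, jacobiSn, if_pos hx]
  rfl

theorem snPoint_of_not_analyticAt {k ρ x : ℂ} (hx : ¬AnalyticAt ℂ (jacobiSnFun k) x) :
    snPoint k ρ x = (1, 0) := by
  simp only [snPoint, jacobiSn, if_neg hx]
  rfl

theorem q4Form_smul_smul (k α κ r r' : ℂ) (X Y w w' : ℂ × ℂ) :
    q4Form k α κ X Y (r • w) (r' • w') = r * r' * q4Form k α κ X Y w w' := by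
  simp only [q4Form, Prod.smul_fst, Prod.smul_snd, smul_eq_mul]
  ring

/-- The coefficient of `x₁ x₂` in `Q_{α,κ}(x₁, x₂, √k sn x, √k sn (x + α))`, divided by `sn α`. -/
noncomputable def q4Factor (k κ α x : ℂ) : ℂ :=
  1 + k ^ 2 * jacobiSnFun k κ * jacobiSnFun k (α - κ) * jacobiSnFun k x * jacobiSnFun k (x + α)

section local_factorisation

variable {k : ℂ} {r : ℝ} {α κ x : ℂ}

theorem IsSnRadius.mul_q4Factor (hr : IsSnRadius k r) (hα : ‖α‖ < r / 4) (hκ : ‖κ‖ < r / 4)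
    (hx : ‖x‖ < r / 4) :
    jacobiSnFun k α * jacobiSnFun k (x + κ) * q4Factor k κ α x =
        jacobiSnFun k κ * jacobiSnFun k (x + α) + jacobiSnFun k (α - κ) * jacobiSnFun k x ∧
      jacobiSnFun k α * jacobiSnFun k (x + α - κ) * q4Factor k κ α x =
        jacobiSnFun k (α - κ) * jacobiSnFun k (x + α) + jacobiSnFun k κ * jacobiSnFun k x ∧
      jacobiSnFun k (x + κ) * jacobiSnFun k (x + α - κ) * q4Factor k κ α x =
        jacobiSnFun k x * jacobiSnFun k (x + α) + jacobiSnFun k κ * jacobiSnFun k (α - κ) := by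
  have hr0 := hr.pos
  have n1 : ‖x + α‖ < r / 2 := (norm_add_le _ _).trans_lt (by linarith)
  have n2 : ‖α - κ‖ < r / 2 := (norm_sub_le _ _).trans_lt (by linarith)
  have n3 : ‖x + κ‖ < r / 2 := (norm_add_le _ _).trans_lt (by linarith)
  have n4 : ‖x + α - κ‖ < r := (norm_sub_le _ _).trans_lt (by linarith)
  have e1 : x + α - α = x := by ring
  have e2 : x + α - (α - κ) = x + κ := by ring
  have e3 : α - (α - κ) = κ := by ring
  have e4 : x + α - (x + κ) = α - κ := by ring
  have e5 : x + κ - κ = x := by ring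
  simp only [q4Factor]
  refine ⟨?_, ?_, ?_⟩
  · have h := hr.ptolemy (α := x + α) (β := α) (κ := α - κ) (by linarith) (by linarith)
      (by linarith) (by rw [e1]; linarith) (by rw [e2]; linarith) (by rw [e3]; linarith)
    rw [e1, e2, e3] at h
    linear_combination h
  · have h := hr.ptolemy (α := x + α) (β := α) (κ := κ) (by linarith) (by linarith)
      (by linarith) (by rw [e1]; linarith) (by linarith) (by linarith)
    rw [e1] at h
    linear_combination h
  · have h := hr.ptolemy (α := x + α) (β := x + κ) (κ := κ) (by linarith) (by linarith)
      (by linarith) (by rw [e4]; linarith) (by linarith) (by rw [e5]; linarith)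
    rw [e4, e5] at h
    linear_combination h

/-- `Q_{α,κ}(x₁, x₂, √k sn x, √k sn (x + α))` is a product of a polynomial in `x₁`, with the zero
`√k sn (x + κ)`, and a polynomial in `x₂`, with the zero `√k sn (x + α - κ)`. -/
theorem IsSnRadius.q4Form_singular (hr : IsSnRadius k r) {ρ : ℂ} (hρ : ρ ^ 2 = k)
    (hα : ‖α‖ < r / 4) (hκ : ‖κ‖ < r / 4) (hx : ‖x‖ < r / 4) (X Y : ℂ × ℂ) :
    q4Form k α κ X Y (ρ * jacobiSnFun k x, 1) (ρ * jacobiSnFun k (x + α), 1) =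
      jacobiSnFun k α * q4Factor k κ α x * (X.1 - ρ * jacobiSnFun k (x + κ) * X.2) *
        (Y.1 - ρ * jacobiSnFun k (x + α - κ) * Y.2) := by
  obtain ⟨h1, h2, h3⟩ := hr.mul_q4Factor hα hκ hx
  have h4 : q4Factor k κ α x = 1 + k ^ 2 * jacobiSnFun k κ * jacobiSnFun k (α - κ) *
    jacobiSnFun k x * jacobiSnFun k (x + α) := rfl
  simp only [q4Form]
  generalize q4Factor k κ α x = N at *
  generalize jacobiSnFun k (x + α) = s' at *
  generalize jacobiSnFun k x = s at *
  generalize jacobiSnFun k (x + κ) = p at *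
  generalize jacobiSnFun k (x + α - κ) = q at *
  generalize jacobiSnFun k α = a at *
  generalize jacobiSnFun k (α - κ) = e at *
  generalize jacobiSnFun k κ = c at *
  linear_combination (-a * X.1 * Y.1) * h4 + (ρ * X.2 * Y.1) * h1 + (ρ * X.1 * Y.2) * h2
    - (ρ ^ 2 * a * X.2 * Y.2) * h3
    + (a * X.2 * Y.2 * -c * e + k * a * c * e * X.1 * Y.1 * s * s') * hρ

/-- As a function of `x`, the logarithmic derivative of `q4Factor k κ α x` is
`k² sn κ (J (x + α - κ) - J x)` with `J z = sn z sn (z + κ)`. -/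
theorem IsSnRadius.deriv_q4Factor (hr : IsSnRadius k r) (hα : ‖α‖ < r / 4) (hα0 : α ≠ 0)
    (hκ : ‖κ‖ < r / 4) (hx : ‖x‖ < r / 4) :
    HasDerivAt (q4Factor k κ α) (k ^ 2 * jacobiSnFun k κ * q4Factor k κ α x *
      (jacobiSnFun k (x + α - κ) * jacobiSnFun k (x + α) -
        jacobiSnFun k x * jacobiSnFun k (x + κ))) x := by
  have hr0 := hr.pos
  have n1 : ‖x + α‖ < r := (norm_add_le _ _).trans_lt (by linarith)
  have d1 := (hr.analyticAt x (by linarith)).differentiableAt.hasDerivAt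
  have d2 := (hr.analyticAt (x + α) n1).differentiableAt.hasDerivAt.comp_add_const x α
  have d3 := ((d1.const_mul (k ^ 2 * jacobiSnFun k κ * jacobiSnFun k (α - κ))).mul d2).const_add 1
  refine d3.congr_deriv ?_
  obtain ⟨h1, h2, -⟩ := hr.mul_q4Factor hα hκ hx
  have h3 := jacobiSnFun_sub_mul_add (hr.analyticAt (x + α) n1) (hr.analyticAt x (by linarith))
    (by rw [add_sub_cancel_left]; exact hr.analyticAt α (by linarith))
  rw [add_sub_cancel_left] at h3
  apply mul_left_cancel₀ (hr.ne_zero α (by linarith) hα0)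
  linear_combination (k ^ 2 * jacobiSnFun k κ) * (jacobiSnFun k (α - κ) * h3
    - jacobiSnFun k (x + α) * h2 + jacobiSnFun k x * h1)

/-- The factor `q4Factor k κ α x` splits into functions of `α`, `x` and `x + α`: these are
exponentials of a primitive of the function `J` in `IsSnRadius.deriv_q4Factor`. -/
theorem IsSnRadius.exists_q4Factor_eq (hr : IsSnRadius k r) (hκ : ‖κ‖ < r / 4) :
    ∃ c F G : ℂ → ℂ, ∀ α x, ‖α‖ < r / 4 → α ≠ 0 → ‖x‖ < r / 4 →
      q4Factor k κ α x = c α * F x * G (x + α) := by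
  have hr0 := hr.pos
  have hJ : DifferentiableOn ℂ (fun z => jacobiSnFun k z * jacobiSnFun k (z + κ))
      (Metric.ball 0 (3 * (r / 4))) := by
    intro z hz
    rw [mem_ball_zero_iff] at hz
    have n1 : ‖z + κ‖ < r := (norm_add_le _ _).trans_lt (by linarith)
    exact ((hr.analyticAt z (by linarith)).differentiableAt.mul
      ((hr.analyticAt _ n1).differentiableAt.hasDerivAt.comp_add_const
        z κ).differentiableAt).differentiableWithinAt
  obtain ⟨I, -, hI⟩ := hJ.isExactOn_ball.with_val_at 0 0
  simp only [mem_ball_zero_iff] at hI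
  refine ⟨fun α => Complex.exp (-(k ^ 2 * jacobiSnFun k κ) * (I (α - κ) - I 0)),
    fun x => Complex.exp (-(k ^ 2 * jacobiSnFun k κ) * I x),
    fun y => Complex.exp ((k ^ 2 * jacobiSnFun k κ) * I (y - κ)), fun α x hα hα0 hx => ?_⟩
  let H : ℂ → ℂ := fun z => q4Factor k κ α z *
    Complex.exp (-(k ^ 2 * jacobiSnFun k κ) * (I (z + (α - κ)) - I z))
  have hH : ∀ z ∈ Metric.ball (0 : ℂ) (r / 4), HasDerivAt H 0 z := by
    intro z hz
    rw [mem_ball_zero_iff] at hz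
    have n1 : ‖α - κ‖ < r / 2 := (norm_sub_le _ _).trans_lt (by linarith)
    have n2 : ‖z + (α - κ)‖ < 3 * (r / 4) := (norm_add_le _ _).trans_lt (by linarith)
    have d1 := (hI _ n2).comp_add_const z (α - κ)
    have d2 := ((d1.sub (hI z (by linarith))).const_mul (-(k ^ 2 * jacobiSnFun k κ))).cexp
    refine ((hr.deriv_q4Factor hα hα0 hκ hz).mul d2).congr_deriv ?_
    have e1 : z + (α - κ) + κ = z + α := by ring
    have e2 : z + (α - κ) = z + α - κ := by ring
    rw [e1, e2]
    ring
  have hconst := Metric.isOpen_ball.is_const_of_deriv_eq_zero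
    (convex_ball (0 : ℂ) (r / 4)).isPreconnected
    (fun z hz => (hH z hz).differentiableAt.differentiableWithinAt)
    (fun z hz => (hH z hz).deriv) (mem_ball_zero_iff.2 hx)
    (Metric.mem_ball_self (by linarith))
  have h0 : q4Factor k κ α 0 = 1 := by simp [q4Factor, jacobiSnFun_zero]
  simp only [H, h0, zero_add, one_mul] at hconst
  beta_reduce
  rw [← hconst, mul_assoc, mul_assoc, ← Complex.exp_add, ← Complex.exp_add]
  have e3 : x + (α - κ) = x + α - κ := by ring
  rw [e3, show ∀ C : ℂ, -C * (I (x + α - κ) - I x) + (-C * I x + C * I (x + α - κ)) = 0 from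
    fun C => by ring, Complex.exp_zero, mul_one]

/-- For small arguments `Q_{α,κ}(x₁, x₂, √k sn x, √k sn (x + α))` is a product of a function of
`α`, a function of `x₁` and `x`, and a function of `x₂` and `x + α`. -/
theorem IsSnRadius.exists_q4Form_eq (hr : IsSnRadius k r) {ρ : ℂ} (hρ : ρ ^ 2 = k)
    (hκ : ‖κ‖ < r / 4) :
    ∃ (c : ℂ → ℂ) (Φ Ψ : ℂ → ℂ × ℂ → ℂ), ∀ α x, ‖α‖ < r / 4 → ‖x‖ < r / 4 → ∀ X Y,
      q4Form k α κ X Y (ρ * jacobiSnFun k x, 1) (ρ * jacobiSnFun k (x + α), 1) =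
        c α * Φ x X * Ψ (x + α) Y := by
  obtain ⟨c, F, G, h⟩ := hr.exists_q4Factor_eq hκ
  refine ⟨fun α => jacobiSnFun k α * c α, fun x X => F x * (X.1 - ρ * jacobiSnFun k (x + κ) * X.2),
    fun y Y => G y * (Y.1 - ρ * jacobiSnFun k (y - κ) * Y.2), fun α x hα hx X Y => ?_⟩
  rw [hr.q4Form_singular hρ hα hκ hx]
  rcases eq_or_ne α 0 with rfl | hα0
  · simp [jacobiSnFun_zero]
  · rw [h α x hα hα0 hx]
    ring

end local_factorisation

/-! ### The cyclic identity at the singular solution -/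

theorem tendsto_cobounded_jacobiSnFun {k x : ℂ} (hx : ¬AnalyticAt ℂ (jacobiSnFun k) x) :
    Tendsto (jacobiSnFun k) (𝓝[≠] x) (Bornology.cobounded ℂ) := by
  refine tendsto_cobounded_of_meromorphicOrderAt_neg (lt_of_not_ge fun h => hx ?_)
  exact ((jacobiSnFun_spec k).meromorphicNFAt x).meromorphicOrderAt_nonneg_iff_analyticAt.1 h

/-- At a pole `x` of `sn`, `[√k sn (t x) : 1] = [1 : 1 / (√k sn (t x))]` tends to `[1 : 0]` as
`t → 1`. There are no poles if `k = 0`, when `sn = sin`. -/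
theorem exists_tendsto_smul_snPoint {k ρ : ℂ} (hρ : ρ ^ 2 = k) (x : ℂ) :
    ∃ r : ℂ → ℂ, Tendsto (fun t => r t • ((ρ * jacobiSnFun k (t * x), 1) : ℂ × ℂ)) (𝓝[≠] 1)
      (𝓝 (snPoint k ρ x)) := by
  by_cases hx : AnalyticAt ℂ (jacobiSnFun k) x
  · refine ⟨fun _ => 1, ?_⟩
    have h1 := continuousAt_comp_mul hx.continuousAt
    have h2 : ContinuousAt (fun t => ((ρ * jacobiSnFun k (t * x), 1) : ℂ × ℂ)) 1 := by fun_prop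
    simpa [snPoint_of_analyticAt hx] using h2.tendsto.mono_left nhdsWithin_le_nhds
  · have hρ0 : ρ ≠ 0 := by
      rintro rfl
      obtain rfl : k = 0 := by simpa using hρ.symm
      exact hx (jacobiSnFun_modulus_zero ▸ Complex.analyticAt_sin)
    have hx0 : x ≠ 0 := by
      rintro rfl
      exact hx (jacobiSnFun_spec k).analyticAt_zero
    have h1 : Tendsto (fun t : ℂ => t * x) (𝓝[≠] 1) (𝓝[≠] x) := by
      refine tendsto_nhdsWithin_iff.2 ⟨?_, ?_⟩
      · have : ContinuousAt (fun t : ℂ => t * x) 1 := by fun_prop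
        simpa using this.tendsto.mono_left nhdsWithin_le_nhds
      · filter_upwards [self_mem_nhdsWithin] with t ht
        simpa [hx0] using ht
    have h2 := (tendsto_cobounded_jacobiSnFun hx).comp h1
    refine ⟨fun t => (ρ * jacobiSnFun k (t * x))⁻¹, ?_⟩
    rw [snPoint_of_not_analyticAt hx]
    have h3 : Tendsto (fun t => ρ⁻¹ * (jacobiSnFun k (t * x))⁻¹) (𝓝[≠] 1) (𝓝 (ρ⁻¹ * 0)) :=
      (tendsto_inv₀_cobounded.comp h2).const_mul _
    rw [mul_zero] at h3
    refine ((tendsto_const_nhds (x := (1 : ℂ))).prodMk_nhds h3).congr' ?_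
    filter_upwards [h2.eventually_ne_cobounded 0] with t ht
    have : jacobiSnFun k (t * x) ≠ 0 := ht
    simp only [Prod.smul_mk, smul_eq_mul, mul_one, Prod.mk.injEq]
    constructor <;> field_simp

theorem tendsto_q4Form {k α κ : ℂ} (h : Q4Finite k α κ) (X Y : ℂ × ℂ) {v v' : ℂ → ℂ × ℂ}
    {w w' : ℂ × ℂ} (hv : Tendsto v (𝓝[≠] 1) (𝓝 w)) (hv' : Tendsto v' (𝓝[≠] 1) (𝓝 w')) :
    Tendsto (fun t => q4Form k (t * α) (t * κ) X Y (v t) (v' t)) (𝓝[≠] 1)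
      (𝓝 (q4Form k α κ X Y w w')) := by
  have c : ∀ {z}, jacobiSn k z ≠ OnePoint.infty →
      Tendsto (fun t => jacobiSnFun k (t * z)) (𝓝[≠] 1) (𝓝 (jacobiSnFun k z)) := fun {z} hz => by
    have := (continuousAt_comp_mul (jacobiSn_ne_infty_iff.1 hz).continuousAt).tendsto
    rw [one_mul] at this
    exact this.mono_left nhdsWithin_le_nhds
  have h1 := c h.1
  have h2 := c h.2.1
  have h3 := c h.2.2
  have hcont : Continuous (fun p : (ℂ × ℂ × ℂ) × ((ℂ × ℂ) × ℂ × ℂ) =>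
      p.1.1 * (X.1 * Y.1 * p.2.1.2 * p.2.2.2 + X.2 * Y.2 * p.2.1.1 * p.2.2.1)
      - p.1.2.1 * (X.1 * p.2.1.1 * Y.2 * p.2.2.2 + X.2 * p.2.1.2 * Y.1 * p.2.2.1)
      - p.1.2.2 * (X.1 * p.2.2.1 * Y.2 * p.2.1.2 + X.2 * p.2.2.2 * Y.1 * p.2.1.1
        - k * p.1.1 * p.1.2.1 * (X.2 * Y.2 * p.2.1.2 * p.2.2.2
          + X.1 * Y.1 * p.2.1.1 * p.2.2.1))) := by fun_prop
  have := (hcont.tendsto _).comp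
    ((h1.prodMk_nhds (h2.prodMk_nhds h3)).prodMk_nhds (hv.prodMk_nhds hv'))
  simp only [q4Form, ← mul_sub]
  exact this

theorem meromorphicAt_q4Form (k ρ α κ x x' : ℂ) (X Y : ℂ × ℂ) (t : ℂ) :
    MeromorphicAt (fun t => q4Form k (t * α) (t * κ) X Y (ρ * jacobiSnFun k (t * x), 1)
      (ρ * jacobiSnFun k (t * x'), 1)) t := by
  have m := fun z t => meromorphicAt_comp_mul (meromorphicAt_jacobiSnFun k) z t
  simp only [q4Form, ← mul_sub]
  fun_prop

/-- The two products of values of the Q4 polynomial that occur in the numerator and denominator of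
the Schwarzian KP equation agree. Both sides are linear in the homogeneous coordinates of each of the
six points `√k sn`, so these may be rescaled before passing to the limit at a pole. -/
theorem q4Form_snPoint_cyclic {k ρ : ℂ} (hρ : ρ ^ 2 = k) {α β γ κ : ℂ} (hα : Q4Finite k α κ)
    (hβ : Q4Finite k β κ) (hγ : Q4Finite k γ κ) (x : ℂ) (X₁ X₂ X₃ Y₁₂ Y₂₃ Y₁₃ : ℂ × ℂ) :
    q4Form k α κ X₂ Y₁₂ (snPoint k ρ (x + β)) (snPoint k ρ (x + α + β)) *
        q4Form k β κ X₃ Y₂₃ (snPoint k ρ (x + γ)) (snPoint k ρ (x + β + γ)) *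
        q4Form k γ κ X₁ Y₁₃ (snPoint k ρ (x + α)) (snPoint k ρ (x + α + γ)) =
      q4Form k β κ X₁ Y₁₂ (snPoint k ρ (x + α)) (snPoint k ρ (x + α + β)) *
        q4Form k γ κ X₂ Y₂₃ (snPoint k ρ (x + β)) (snPoint k ρ (x + β + γ)) *
        q4Form k α κ X₃ Y₁₃ (snPoint k ρ (x + γ)) (snPoint k ρ (x + α + γ)) := by
  obtain ⟨r, hr⟩ := exists_isSnRadius k
  let V : ℂ → ℂ → ℂ × ℂ := fun z t => (ρ * jacobiSnFun k (t * z), 1)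
  have m : ∀ α κ X Y z z' t, MeromorphicAt
      (fun t => q4Form k (t * α) (t * κ) X Y (V z t) (V z' t)) t :=
    fun α κ X Y z z' t => meromorphicAt_q4Form k ρ α κ z z' X Y t
  have key := eventually_eq_of_eventuallyEq_zero
    (F := fun t => q4Form k (t * α) (t * κ) X₂ Y₁₂ (V (x + β) t) (V (x + α + β) t) *
      q4Form k (t * β) (t * κ) X₃ Y₂₃ (V (x + γ) t) (V (x + β + γ) t) *
      q4Form k (t * γ) (t * κ) X₁ Y₁₃ (V (x + α) t) (V (x + α + γ) t))
    (G := fun t => q4Form k (t * β) (t * κ) X₁ Y₁₂ (V (x + α) t) (V (x + α + β) t) *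
      q4Form k (t * γ) (t * κ) X₂ Y₂₃ (V (x + β) t) (V (x + β + γ) t) *
      q4Form k (t * α) (t * κ) X₃ Y₁₃ (V (x + γ) t) (V (x + α + γ) t))
    (fun t => ((m ..).mul (m ..)).mul (m ..)) (fun t => ((m ..).mul (m ..)).mul (m ..)) ?_
  · choose s hs using exists_tendsto_smul_snPoint hρ
    have lim := fun {α} (hα : Q4Finite k α κ) X Y z z' => tendsto_q4Form hα X Y (hs z) (hs z')
    refine tendsto_nhds_unique_of_eventuallyEq
      (((lim hα X₂ Y₁₂ (x + β) (x + α + β)).mul (lim hβ X₃ Y₂₃ (x + γ) (x + β + γ))).mul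
        (lim hγ X₁ Y₁₃ (x + α) (x + α + γ)))
      (((lim hβ X₁ Y₁₂ (x + α) (x + α + β)).mul (lim hγ X₂ Y₂₃ (x + β) (x + β + γ))).mul
        (lim hα X₃ Y₁₃ (x + γ) (x + α + γ))) ?_
    filter_upwards [key] with t ht
    simp only [q4Form_smul_smul]
    linear_combination (s (x + α) t * s (x + β) t * s (x + γ) t * s (x + α + β) t
      * s (x + β + γ) t * s (x + α + γ) t) * ht
  · have hr4 : 0 < r / 4 := by linarith [hr.pos]
    filter_upwards [eventually_norm_mul_lt κ hr4, eventually_norm_mul_lt α hr4,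
      eventually_norm_mul_lt β hr4, eventually_norm_mul_lt γ hr4,
      eventually_norm_mul_lt (x + α) hr4, eventually_norm_mul_lt (x + β) hr4,
      eventually_norm_mul_lt (x + γ) hr4] with t hκ' hα' hβ' hγ' h1 h2 h3
    obtain ⟨c, Φ, Ψ, h⟩ := hr.exists_q4Form_eq hρ hκ'
    have e1 := h _ _ hα' h2 X₂ Y₁₂
    have e2 := h _ _ hβ' h3 X₃ Y₂₃
    have e3 := h _ _ hγ' h1 X₁ Y₁₃
    have e4 := h _ _ hβ' h1 X₁ Y₁₂
    have e5 := h _ _ hγ' h2 X₂ Y₂₃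
    have e6 := h _ _ hα' h3 X₃ Y₁₃
    simp only [← mul_add, add_right_comm x β α, add_right_comm x γ β, add_right_comm x γ α]
      at e1 e2 e3 e4 e5 e6
    simp only [V, e1, e2, e3, e4, e5, e6]
    ring

/-! ### Compatibility of the Riccati maps: polynomial identities -/

/-- The diagonal entries of the compatibility relation `riccati_compat`. The variables `a`, `b`, `c`,
`d`, `e`, `f` stand for `sn` at `α`, `β`, `κ`, `α - β`, `α - κ`, `β - κ`, and `A`, `B` for `sn'` at
`α`, `β`. The difference of the two sides is a multiple of the Q4 polynomial modulo the relations
between these values; the multiplier has degree `2` in `(u, u')`, and its three coefficients are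
determined by comparing the terms linear in `x`. -/
theorem riccati_compat_diagonal {k a b c d e f A B u u' z z' y y' x x' : ℂ}
    (r1 : c * (a * e - b * f) = d * (a * b - e * f))
    (r2 : b * e - a * f = c * d * (1 - k ^ 2 * (a * b * e * f)))
    (r3 : a * B - b * A = d * (1 - k ^ 2 * a ^ 2 * b ^ 2))
    (r6 : c * f * (a * B + b * A) + b * e * f * (1 - k ^ 2 * a ^ 2 * c ^ 2) = a * (b ^ 2 - c ^ 2))
    (r6' : c * e * (a * B + b * A) + a * e * f * (1 - k ^ 2 * b ^ 2 * c ^ 2) = b * (a ^ 2 - c ^ 2))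
    (hP : a * (u * z * (y' * x') + u' * z' * (y * x)) - b * (u * y * (z' * x') + u' * y' * (z * x))
      - d * (u * x * (z' * y') + u' * x' * (z * y)
        - k * a * b * (u' * z' * (y' * x') + u * z * (y * x))) = 0) :
    b * (u ^ 2 * z' ^ 2 + u' ^ 2 * z ^ 2 - k * a ^ 2 * (u' ^ 2 * z' ^ 2 + u ^ 2 * z ^ 2)
        - 2 * A * (u * u' * (z * z'))) *
      ((c * y * x' + e * y' * x) * (c * u * y' + f * u' * y)
        - (a * y * x + k * a * c * e * y' * x') * (b * u' * y' + k * b * c * f * u * y)) =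
    a * (u ^ 2 * y' ^ 2 + u' ^ 2 * y ^ 2 - k * b ^ 2 * (u' ^ 2 * y' ^ 2 + u ^ 2 * y ^ 2)
        - 2 * B * (u * u' * (y * y'))) *
      ((c * z * x' + f * z' * x) * (c * u * z' + e * u' * z)
        - (b * z * x + k * b * c * f * z' * x') * (a * u' * z' + k * a * c * e * u * z)) := by
  linear_combination
    (u' ^ 2 * (a * b - e * f) * (y * z + k * a * b * y' * z')
      - u * u' * ((1 - k ^ 2 * a ^ 2 * b ^ 2) * c * (f * y * z' + e * y' * z))
      - u ^ 2 * (c ^ 2 * (1 - k ^ 2 * (a * b * e * f)) * (y' * z' + k * a * b * (y * z)))) * hP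
    + (k ^ 2 * a ^ 2 * b ^ 2 * (u' ^ 3 * z' ^ 2 * y' ^ 2 * x') - u' ^ 3 * z ^ 2 * y ^ 2 * x'
      - k * a * b * (u * u' ^ 2 * z' ^ 2 * y' ^ 2 * x) + k * a * b * (u * u' ^ 2 * z ^ 2 * y ^ 2 * x)
      + (1 - k ^ 2 * a ^ 2 * b ^ 2) * (u * u' ^ 2 * (z * z') * (y * y') * x)) * r1
    + (-k * a * b * c * (u ^ 2 * u' * z' ^ 2 * y' ^ 2 * x')
      - c * (1 - k ^ 2 * a ^ 2 * b ^ 2) * (u ^ 2 * u' * (z * z') * (y * y') * x')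
      + k * a * b * c * (u ^ 2 * u' * z ^ 2 * y ^ 2 * x') + c * (u ^ 3 * z' ^ 2 * y' ^ 2 * x)
      - k ^ 2 * a ^ 2 * b ^ 2 * c * (u ^ 3 * z ^ 2 * y ^ 2 * x)) * r2
    + (-k * a * b * c * f * (u * u' ^ 2 * z' ^ 2 * (y * y') * x')
      - k * a * b * c * e * (u * u' ^ 2 * (z * z') * y' ^ 2 * x')
      - 2 * (a * b - e * f) * (u * u' ^ 2 * (z * z') * (y * y') * x)
      + c * f * (u * u' ^ 2 * (z * z') * y ^ 2 * x') + c * e * (u * u' ^ 2 * z ^ 2 * (y * y') * x')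
      + c * f * (u ^ 2 * u' * z' ^ 2 * (y * y') * x) + c * e * (u ^ 2 * u' * (z * z') * y' ^ 2 * x)
      + 2 * c ^ 2 * (1 - k ^ 2 * (a * b * e * f)) * (u ^ 2 * u' * (z * z') * (y * y') * x')
      - k * a * b * c * f * (u ^ 2 * u' * (z * z') * y ^ 2 * x)
      - k * a * b * c * e * (u ^ 2 * u' * z ^ 2 * (y * y') * x)) * r3
    + (-k * a * b * (u * u' ^ 2 * z' ^ 2 * (y * y') * x') - u * u' ^ 2 * (z * z') * y ^ 2 * x'
      + u ^ 2 * u' * z' ^ 2 * (y * y') * x + k * a * b * (u ^ 2 * u' * (z * z') * y ^ 2 * x)) * r6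
    + (k * a * b * (u * u' ^ 2 * (z * z') * y' ^ 2 * x') + u * u' ^ 2 * z ^ 2 * (y * y') * x'
      - u ^ 2 * u' * (z * z') * y' ^ 2 * x - k * a * b * (u ^ 2 * u' * z ^ 2 * (y * y') * x)) * r6'

/-- The off-diagonal entries of the compatibility relation `riccati_compat`; see
`riccati_compat_diagonal` for the notation. -/
theorem riccati_compat_offDiagonal {k a b c d e f A B u u' z z' y y' x x' : ℂ}
    (r1 : c * (a * e - b * f) = d * (a * b - e * f))
    (r2 : b * e - a * f = c * d * (1 - k ^ 2 * (a * b * e * f)))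
    (r3 : a * B - b * A = d * (1 - k ^ 2 * a ^ 2 * b ^ 2))
    (r7 : a ^ 2 + d ^ 2 - b ^ 2 - k ^ 2 * a ^ 2 * b ^ 2 * d ^ 2 = 2 * a * d * B)
    (hP : a * (u * z * (y' * x') + u' * z' * (y * x)) - b * (u * y * (z' * x') + u' * y' * (z * x))
      - d * (u * x * (z' * y') + u' * x' * (z * y)
        - k * a * b * (u' * z' * (y' * x') + u * z * (y * x))) = 0) :
    b * (u ^ 2 * z' ^ 2 + u' ^ 2 * z ^ 2 - k * a ^ 2 * (u' ^ 2 * z' ^ 2 + u ^ 2 * z ^ 2)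
        - 2 * A * (u * u' * (z * z'))) *
      ((a * y * x + k * a * c * e * y' * x') * (c * u' * y + f * u * y')
        - (c * y * x' + e * y' * x) * (b * u * y + k * b * c * f * u' * y')) =
    a * (u ^ 2 * y' ^ 2 + u' ^ 2 * y ^ 2 - k * b ^ 2 * (u' ^ 2 * y' ^ 2 + u ^ 2 * y ^ 2)
        - 2 * B * (u * u' * (y * y'))) *
      ((b * z * x + k * b * c * f * z' * x') * (c * u' * z + e * u * z')
        - (c * z * x' + f * z' * x) * (a * u * z + k * a * c * e * u' * z')) := by
  have r8 : d * (a * B + b * A) = a ^ 2 - b ^ 2 := by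
    linear_combination -r7 - d * r3
  linear_combination
    (-(u' ^ 2 * (k * c * (a * b - e * f) * (a * y * z' + b * z * y')))
      + u * u' * ((k * a * b * (b * e - a * f) - 2 * k * a * c * e * f * B
          - k * c * d * (a * b - e * f)) * (y' * z')
        + ((b * e - a * f) - 2 * a * c * B - k ^ 2 * a * b * c * d * (a * b - e * f)) * (y * z))
      + u ^ 2 * (c * (1 - k ^ 2 * (a * b * e * f)) * (b * y * z' + a * z * y'))) * hP
    + (-k ^ 2 * a ^ 2 * b * c * (u' ^ 3 * z' ^ 2 * (y * y') * x')
      - k ^ 2 * a * b ^ 2 * c * (u' ^ 3 * (z * z') * y' ^ 2 * x')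
      + k * a * c * (u' ^ 3 * (z * z') * y ^ 2 * x') + k * b * c * (u' ^ 3 * z ^ 2 * (y * y') * x')
      - 2 * k * c * (a * B + b * A) * (u * u' ^ 2 * (z * z') * (y * y') * x')
      + k * b * c * (u ^ 2 * u' * z' ^ 2 * (y * y') * x')
      + k * a * c * (u ^ 2 * u' * (z * z') * y' ^ 2 * x')
      - k ^ 2 * a * b ^ 2 * c * (u ^ 2 * u' * (z * z') * y ^ 2 * x')
      - k ^ 2 * a ^ 2 * b * c * (u ^ 2 * u' * z ^ 2 * (y * y') * x')) * r1
    + (-k ^ 2 * a ^ 2 * b ^ 2 * d * (u * u' ^ 2 * z' ^ 2 * y' ^ 2 * x')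
      + 2 * k * a * b ^ 2 * (u * u' ^ 2 * (z * z') * y' ^ 2 * x)
      - 2 * a * (u * u' ^ 2 * (z * z') * y ^ 2 * x) + d * (u * u' ^ 2 * z ^ 2 * y ^ 2 * x')
      + k * a * b * d * (u ^ 2 * u' * z' ^ 2 * y' ^ 2 * x)
      + k * a * b ^ 2 * (u ^ 2 * u' * z' ^ 2 * (y * y') * x')
      - k * a ^ 2 * b * (u ^ 2 * u' * (z * z') * y' ^ 2 * x')
      + (d * (1 - k ^ 2 * a ^ 2 * b ^ 2) + 2 * (a * B + b * A))
        * (u ^ 2 * u' * (z * z') * (y * y') * x)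
      + b * (u ^ 2 * u' * (z * z') * y ^ 2 * x') - a * (u ^ 2 * u' * z ^ 2 * (y * y') * x')
      - k * a * b * d * (u ^ 2 * u' * z ^ 2 * y ^ 2 * x) - b * (u ^ 3 * z' ^ 2 * (y * y') * x)
      - a * (u ^ 3 * (z * z') * y' ^ 2 * x) + k * a * b ^ 2 * (u ^ 3 * (z * z') * y ^ 2 * x)
      + k * a ^ 2 * b * (u ^ 3 * z ^ 2 * (y * y') * x)) * r2
    + (-2 * k * b * c * e * f * (u * u' ^ 2 * (z * z') * y' ^ 2 * x)
      + 2 * a * c * (u * u' ^ 2 * (z * z') * y ^ 2 * x)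
      + 2 * k * a * c * e * f * (u ^ 2 * u' * (z * z') * y' ^ 2 * x')
      - 2 * b * c * (u ^ 2 * u' * (z * z') * y ^ 2 * x')) * r3
    + (-k ^ 2 * a * b * c * e * f * (u * u' ^ 2 * z' ^ 2 * y' ^ 2 * x')
      - k * c * (a * b - e * f) * (u * u' ^ 2 * (z * z') * (y * y') * x')
      + c * (u * u' ^ 2 * z ^ 2 * y ^ 2 * x') + k * c * e * f * (u ^ 2 * u' * z' ^ 2 * y' ^ 2 * x)
      + c * (1 - k ^ 2 * (a * b * e * f)) * (u ^ 2 * u' * (z * z') * (y * y') * x)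
      - k * a * b * c * (u ^ 2 * u' * z ^ 2 * y ^ 2 * x)) * r7
    + (-2 * k * c * (a * b - e * f) * (u * u' ^ 2 * (z * z') * (y * y') * x')
      + 2 * c * (1 - k ^ 2 * (a * b * e * f)) * (u ^ 2 * u' * (z * z') * (y * y') * x)) * r8

/-! ### The Riccati maps as linear maps -/

/-- The symplectic form on `ℂ²`; `homDiff` is its value at homogeneous coordinates. -/
def wedge (v w : ℂ × ℂ) : ℂ := v.1 * w.2 - w.1 * v.2

theorem homDiff_eq_wedge (x y : OnePoint ℂ) : homDiff x y = wedge (homCoord x) (homCoord y) := rfl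

theorem wedge_smul_left (r : ℂ) (v w : ℂ × ℂ) : wedge (r • v) w = r * wedge v w := by
  simp only [wedge, Prod.smul_fst, Prod.smul_snd, smul_eq_mul]; ring

theorem wedge_smul_right (r : ℂ) (v w : ℂ × ℂ) : wedge v (r • w) = r * wedge v w := by
  simp only [wedge, Prod.smul_fst, Prod.smul_snd, smul_eq_mul]; ring

theorem homCoord_ne_zero (x : OnePoint ℂ) : homCoord x ≠ 0 := by
  cases x <;> simp [homCoord]

theorem exists_eq_smul_homCoord {v : ℂ × ℂ} {y : OnePoint ℂ} (h : wedge v (homCoord y) = 0) :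
    ∃ μ : ℂ, v = μ • homCoord y := by
  obtain ⟨p, q⟩ := v
  cases y with
  | infty =>
    change p * 0 - 1 * q = 0 at h
    refine ⟨p, ?_⟩
    change (p, q) = p • ((1, 0) : ℂ × ℂ)
    simp only [Prod.smul_mk, smul_eq_mul, mul_one, mul_zero, Prod.mk.injEq, true_and]
    linear_combination -h
  | coe z =>
    change p * 1 - z * q = 0 at h
    refine ⟨q, ?_⟩
    change (p, q) = q • ((z, 1) : ℂ × ℂ)
    simp only [Prod.smul_mk, smul_eq_mul, mul_one, Prod.mk.injEq, and_true]
    linear_combination h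

/-- The linear map of `ℂ²` inducing the Möbius transformation `v ↦ v'` defined by
`Q_{α,κ}(u, u', v, v') = 0`. -/
noncomputable def riccati (k α κ : ℂ) (p q v : ℂ × ℂ) : ℂ × ℂ :=
  ((jacobiSnFun k α * p.1 * q.1 + k * jacobiSnFun k α * jacobiSnFun k κ * jacobiSnFun k (α - κ)
        * p.2 * q.2) * v.2
      - (jacobiSnFun k κ * p.1 * q.2 + jacobiSnFun k (α - κ) * p.2 * q.1) * v.1,
    (jacobiSnFun k κ * q.1 * p.2 + jacobiSnFun k (α - κ) * q.2 * p.1) * v.2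
      - (jacobiSnFun k α * p.2 * q.2 + k * jacobiSnFun k α * jacobiSnFun k κ
        * jacobiSnFun k (α - κ) * p.1 * q.1) * v.1)

/-- The determinant of `riccati k α κ p q`. -/
noncomputable def riccatiDet (k α κ : ℂ) (p q : ℂ × ℂ) : ℂ :=
  wedge (riccati k α κ p q (1, 0)) (riccati k α κ p q (0, 1))

theorem q4Form_eq_wedge (k α κ : ℂ) (p q v v' : ℂ × ℂ) :
    q4Form k α κ p q v v' = wedge (riccati k α κ p q v) v' := by
  simp only [q4Form, wedge, riccati]
  ring

theorem riccati_smul (k α κ r : ℂ) (p q v : ℂ × ℂ) :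
    riccati k α κ p q (r • v) = r • riccati k α κ p q v := by
  ext <;> simp only [riccati, Prod.smul_fst, Prod.smul_snd, smul_eq_mul] <;> ring

theorem wedge_riccati (k α κ : ℂ) (p q v w : ℂ × ℂ) :
    wedge (riccati k α κ p q v) (riccati k α κ p q w) = riccatiDet k α κ p q * wedge v w := by
  simp only [riccatiDet, wedge, riccati]
  ring

theorem biquadratic_q4Form (k α κ : ℂ) (u u' : OnePoint ℂ) :
    (q4Form k α κ).biquadratic u u' = -riccatiDet k α κ (homCoord u) (homCoord u') := by
  simp only [QuadForm.biquadratic, q4Form, riccatiDet, wedge, riccati]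
  ring

/-- The biquadratic polynomial `x₁² + x₂² - k sn² α (1 + x₁² x₂²) - 2 sn' α x₁ x₂` of the edges with
parameter `α`, homogenised. The polynomial `H` of `Q_{α,κ}` is `sn κ sn (α - κ)` times `edgePoly`,
so that `κ` enters only through a constant. -/
noncomputable def edgePoly (k α : ℂ) (p q : ℂ × ℂ) : ℂ :=
  p.1 ^ 2 * q.2 ^ 2 + p.2 ^ 2 * q.1 ^ 2
    - k * jacobiSnFun k α ^ 2 * (p.2 ^ 2 * q.2 ^ 2 + p.1 ^ 2 * q.1 ^ 2)
    - 2 * deriv (jacobiSnFun k) α * (p.1 * p.2 * (q.1 * q.2))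

theorem riccatiDet_eq {k α κ : ℂ} (h : Q4Finite k α κ) (p q : ℂ × ℂ) :
    riccatiDet k α κ p q = -(jacobiSnFun k κ * jacobiSnFun k (α - κ)) * edgePoly k α p q := by
  have h1 := jacobiSnFun_triangle (jacobiSn_ne_infty_iff.1 h.1) (jacobiSn_ne_infty_iff.1 h.2.1)
    (jacobiSn_ne_infty_iff.1 h.2.2)
  simp only [riccatiDet, wedge, riccati, edgePoly]
  linear_combination (-(p.1 * p.2 * (q.1 * q.2))) * h1

theorem edgePoly_ne_zero {k α κ : ℂ} (h : Q4Finite k α κ) {p q : ℂ × ℂ}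
    (hd : riccatiDet k α κ p q ≠ 0) : edgePoly k α p q ≠ 0 := by
  rw [riccatiDet_eq h] at hd
  exact right_ne_zero_of_mul hd

theorem QuadForm.IsRiccatiMap.exists_riccati_eq {k α κ : ℂ} {u u' : OnePoint ℂ} {r : MobiusGroup}
    (hr : (q4Form k α κ).IsRiccatiMap u u' r) {x y : OnePoint ℂ} (hxy : r.1 x = y) :
    ∃ μ : ℂ, riccati k α κ (homCoord u) (homCoord u') (homCoord x) = μ • homCoord y := by
  apply exists_eq_smul_homCoord
  rw [← q4Form_eq_wedge]
  exact (hr x y).2 hxy.symm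

/-- The compatibility of the Riccati maps on an elementary quadrilateral of the lattice, for the
linear maps and with the scalar factor made explicit. -/
theorem riccati_compat {k α β κ : ℂ} (hα : Q4Finite k α κ) (hβ : Q4Finite k β κ)
    (hαβ : Q4Finite k α β) {u u₁ u₂ u₁₂ : ℂ × ℂ} (hP : q4Form k α β u u₁ u₂ u₁₂ = 0) (v : ℂ × ℂ) :
    (jacobiSnFun k β * edgePoly k α u u₁) • riccati k α κ u₂ u₁₂ (riccati k β κ u u₂ v) =
      (jacobiSnFun k α * edgePoly k β u u₂) • riccati k β κ u₁ u₁₂ (riccati k α κ u u₁ v) := by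
  have a1 := jacobiSn_ne_infty_iff.1 hα.1
  have a2 := jacobiSn_ne_infty_iff.1 hβ.1
  have a3 := jacobiSn_ne_infty_iff.1 hα.2.1
  have a4 := jacobiSn_ne_infty_iff.1 hαβ.2.2
  have a5 := jacobiSn_ne_infty_iff.1 hα.2.2
  have a6 := jacobiSn_ne_infty_iff.1 hβ.2.2
  have r1 := jacobiSnFun_ptolemy' a1 a2 a3 a4 a5 a6
  have r2 := jacobiSnFun_ptolemy a1 a2 a3 a4 a5 a6
  have r3 := jacobiSnFun_sub a1 a2 a4
  have s1 := jacobiSnFun_sub a1 a3 a5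
  have s2 := jacobiSnFun_sub a2 a3 a6
  have s3 := jacobiSnFun_sub_mul_add a1 a3 a5
  have s4 := jacobiSnFun_sub_mul_add a2 a3 a6
  have r7 := jacobiSnFun_triangle a1 a2 a4
  simp only [q4Form] at hP
  obtain ⟨u, u'⟩ := u
  obtain ⟨z, z'⟩ := u₁
  obtain ⟨y, y'⟩ := u₂
  obtain ⟨x, x'⟩ := u₁₂
  obtain ⟨v, v'⟩ := v
  simp only at hP
  simp only [riccati, edgePoly, Prod.smul_mk, smul_eq_mul, Prod.mk.injEq]
  generalize jacobiSnFun k (α - β) = d at *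
  generalize jacobiSnFun k (α - κ) = e at *
  generalize jacobiSnFun k (β - κ) = f at *
  generalize jacobiSnFun k α = a at *
  generalize jacobiSnFun k β = b at *
  generalize jacobiSnFun k κ = c at *
  generalize deriv (jacobiSnFun k) α = A at *
  generalize deriv (jacobiSnFun k) β = B at *
  generalize deriv (jacobiSnFun k) κ = C at *
  have r2' : b * e - a * f = c * d * (1 - k ^ 2 * (a * b * e * f)) := r2
  have r3' : a * B - b * A = d * (1 - k ^ 2 * a ^ 2 * b ^ 2) := by linear_combination -r3
  have r6 : c * f * (a * B + b * A) + b * e * f * (1 - k ^ 2 * a ^ 2 * c ^ 2) =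
      a * (b ^ 2 - c ^ 2) := by linear_combination a * s4 + b * f * s1
  have r6' : c * e * (a * B + b * A) + a * e * f * (1 - k ^ 2 * b ^ 2 * c ^ 2) =
      b * (a ^ 2 - c ^ 2) := by linear_combination b * s3 + a * e * s2
  have r7' : a ^ 2 + d ^ 2 - b ^ 2 - k ^ 2 * a ^ 2 * b ^ 2 * d ^ 2 = 2 * a * d * B := by
    linear_combination -r7 + 2 * d * r3
  constructor
  · have e1 := riccati_compat_diagonal (u := u) (u' := u') (z := z) (z' := z') (y := y) (y' := y') (x := x)
      (x' := x') r1 r2' r3' r6 r6' (by linear_combination hP)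
    have e2 := riccati_compat_offDiagonal (u := u) (u' := u') (z := z) (z' := z') (y := y) (y' := y') (x := x)
      (x' := x') r1 r2' r3' r7' (by linear_combination hP)
    linear_combination v * e1 + v' * e2
  · have e1 := riccati_compat_diagonal (u := u') (u' := u) (z := z') (z' := z) (y := y') (y' := y) (x := x')
      (x' := x) r1 r2' r3' r6 r6' (by linear_combination hP)
    have e2 := riccati_compat_offDiagonal (u := u') (u' := u) (z := z') (z' := z) (y := y') (y' := y) (x := x')
      (x' := x) r1 r2' r3' r7' (by linear_combination hP)
    linear_combination v' * e1 + v * e2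

/-! ### One face of an elementary cube -/

/-- On a face with vertices `u, u₁, u₂, u₁₂`, the differences `x₂ - x₁₂` and `x₁ - x₁₂` are given
by the values of the Q4 polynomial at `w`, up to factors that depend on single vertices and the
two factors `τ'`, `τ`, whose ratio is controlled by the compatibility of the Riccati maps. -/
theorem exists_wedge_eq {k α β κ : ℂ} (hα : Q4Finite k α κ) (hβ : Q4Finite k β κ)
    (hαβ : Q4Finite k α β) {u u₁ u₂ u₁₂ : ℂ × ℂ} (hP : q4Form k α β u u₁ u₂ u₁₂ = 0)
    (d₁ : riccatiDet k α κ u u₁ ≠ 0) (d₂ : riccatiDet k β κ u u₂ ≠ 0)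
    (d₁' : riccatiDet k β κ u₁ u₁₂ ≠ 0) (d₂' : riccatiDet k α κ u₂ u₁₂ ≠ 0)
    {x₁ x₂ x₁₂ w₁ w₂ w₁₂ : ℂ × ℂ} {μ₁ μ₂ ν ν' : ℂ} (hw : w₁₂ ≠ 0)
    (h₁ : riccati k α κ u u₁ x₁ = μ₁ • w₁) (h₂ : riccati k β κ u u₂ x₂ = μ₂ • w₂)
    (h₁₂ : riccati k β κ u₁ u₁₂ (riccati k α κ u u₁ x₁₂) = ν • w₁₂)
    (h₂₁ : riccati k α κ u₂ u₁₂ (riccati k β κ u u₂ x₁₂) = ν' • w₁₂) :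
    (jacobiSnFun k α = 0 ↔ jacobiSnFun k β = 0) ∧
    ∃ τ τ' : ℂ, wedge x₁ x₁₂ = τ * μ₁ * q4Form k β κ u₁ u₁₂ w₁ w₁₂ ∧
      wedge x₂ x₁₂ = τ' * μ₂ * q4Form k α κ u₂ u₁₂ w₂ w₁₂ ∧
      τ' * (jacobiSnFun k α * edgePoly k β u u₂) = τ * (jacobiSnFun k β * edgePoly k α u u₁) := by
  have hc := riccati_compat hα hβ hαβ hP
  have e₁ := edgePoly_ne_zero hα d₁
  have e₂ := edgePoly_ne_zero hβ d₂
  set L := jacobiSnFun k β * edgePoly k α u u₁ with hL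
  set R := jacobiSnFun k α * edgePoly k β u u₂ with hR
  -- the determinants of both sides of the compatibility relation
  have hdet : L ^ 2 * (riccatiDet k α κ u₂ u₁₂ * riccatiDet k β κ u u₂) =
      R ^ 2 * (riccatiDet k β κ u₁ u₁₂ * riccatiDet k α κ u u₁) := by
    have h := congrArg₂ wedge (hc (1, 0)) (hc (0, 1))
    simp only [wedge_smul_left, wedge_smul_right, wedge_riccati] at h
    simp only [wedge] at h
    linear_combination h
  have hLR : L * ν' = R * ν := by
    have h := hc x₁₂
    rw [h₁₂, h₂₁, smul_smul, smul_smul] at h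
    exact smul_left_injective ℂ hw h
  have hzero : R = 0 ↔ L = 0 := by
    constructor <;> intro h0 <;> rw [h0] at hdet <;> simpa [d₁, d₂, d₁', d₂'] using hdet
  refine ⟨by simpa [hL, hR, e₁, e₂] using hzero,
    ν / (riccatiDet k β κ u₁ u₁₂ * riccatiDet k α κ u u₁),
    ν' / (riccatiDet k α κ u₂ u₁₂ * riccatiDet k β κ u u₂), ?_, ?_, ?_⟩
  · have h := wedge_riccati k β κ u₁ u₁₂ (riccati k α κ u u₁ x₁) (riccati k α κ u u₁ x₁₂)
    have h' := wedge_riccati k α κ u u₁ x₁ x₁₂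
    rw [h₁] at h h'
    rw [riccati_smul, h₁₂, wedge_smul_left, wedge_smul_right, ← q4Form_eq_wedge, h'] at h
    field_simp
    linear_combination -h
  · have h := wedge_riccati k α κ u₂ u₁₂ (riccati k β κ u u₂ x₂) (riccati k β κ u u₂ x₁₂)
    have h' := wedge_riccati k β κ u u₂ x₂ x₁₂
    rw [h₂] at h h'
    rw [riccati_smul, h₂₁, wedge_smul_left, wedge_smul_right, ← q4Form_eq_wedge, h'] at h
    field_simp
    linear_combination -h
  · by_cases h0 : L = 0
    · rw [h0, hzero.2 h0]; ring
    · field_simp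
      apply mul_left_cancel₀ h0
      linear_combination (R * riccatiDet k β κ u₁ u₁₂ * riccatiDet k α κ u u₁) * hLR - ν * hdet

/-- If `sn α = 0`, then translation by `α` only changes the sign of `sn`, and `Q_{α,κ}` vanishes at
`x₃ = √k sn x`, `x₄ = √k sn (x + α)`, whatever `x₁` and `x₂` are. -/
theorem q4Form_snPoint_eq_zero {k ρ α κ : ℂ} (hα : Q4Finite k α κ) (h0 : jacobiSnFun k α = 0)
    (x : ℂ) (X Y : ℂ × ℂ) :
    q4Form k α κ X Y (snPoint k ρ x) (snPoint k ρ (x + α)) = 0 := by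
  obtain ⟨ε, hε, h⟩ := exists_jacobiSnFun_add_zero (jacobiSn_ne_infty_iff.1 hα.1) h0
  have he : jacobiSnFun k (α - κ) = -(ε * jacobiSnFun k κ) := by
    have := h (-κ)
    rw [jacobiSnFun_neg, neg_add_eq_sub] at this
    linear_combination this
  by_cases hx : AnalyticAt ℂ (jacobiSnFun k) x
  · have hx' : AnalyticAt ℂ (jacobiSnFun k) (x + α) := by
      have h1 : AnalyticAt ℂ (fun y : ℂ => y - α) (x + α) := by fun_prop
      have h2 : AnalyticAt ℂ (jacobiSnFun k) (x + α - α) := by rwa [add_sub_cancel_right]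
      refine ((analyticAt_const (v := ε)).mul
        (AnalyticAt.fun_comp (f := fun y : ℂ => y - α) h2 h1)).congr (Eventually.of_forall ?_)
      intro y
      rw [Pi.mul_apply, ← h (y - α), sub_add_cancel]
    rw [snPoint_of_analyticAt hx, snPoint_of_analyticAt hx', h x]
    simp only [q4Form, h0, he]
    linear_combination (jacobiSnFun k κ * X.1 * Y.2 * ρ * jacobiSnFun k x) * hε
  · have hx' : ¬AnalyticAt ℂ (jacobiSnFun k) (x + α) := by
      intro hx'
      have h1 : AnalyticAt ℂ (fun y : ℂ => y + α) x := by fun_prop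
      refine hx (((analyticAt_const (v := ε)).mul
        (AnalyticAt.fun_comp (f := fun y : ℂ => y + α) hx' h1)).congr (Eventually.of_forall ?_))
      intro y
      rw [Pi.mul_apply, h y]
      linear_combination jacobiSnFun k y * hε
    rw [snPoint_of_not_analyticAt hx, snPoint_of_not_analyticAt hx']
    simp [q4Form, h0]

/-! ### Möbius invariance -/

/-- A Möbius transformation multiplies differences by a constant and by factors depending on the
single points. -/
theorem exists_homDiff_eq (σ : MobiusGroup) : ∃ D : ℂ, D ≠ 0 ∧ ∃ μ : OnePoint ℂ → ℂ,
    ∀ x y, D * homDiff x y = μ x * μ y * homDiff (σ.1 x) (σ.1 y) := by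
  obtain ⟨σ, g, rfl⟩ := σ
  let G : ℂ × ℂ → ℂ × ℂ := fun v => (g 0 0 * v.1 + g 0 1 * v.2, g 1 0 * v.1 + g 1 1 * v.2)
  have hD : g 0 0 * g 1 1 - g 0 1 * g 1 0 ≠ 0 := by
    have := g.det_ne_zero
    rwa [Matrix.det_fin_two] at this
  have key : ∀ x : OnePoint ℂ, ∃ μ : ℂ, G (homCoord x) = μ • homCoord (g • x) := by
    intro x
    cases x with
    | infty =>
      apply exists_eq_smul_homCoord
      rw [OnePoint.smul_infty_eq_ite]
      change wedge (g 0 0 * 1 + g 0 1 * 0, g 1 0 * 1 + g 1 1 * 0) _ = 0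
      split_ifs with h
      · change (g 0 0 * 1 + g 0 1 * 0) * 0 - 1 * (g 1 0 * 1 + g 1 1 * 0) = 0
        rw [h]; ring
      · change (g 0 0 * 1 + g 0 1 * 0) * 1 - (g 0 0 / g 1 0) * (g 1 0 * 1 + g 1 1 * 0) = 0
        field_simp; ring
    | coe z =>
      apply exists_eq_smul_homCoord
      rw [OnePoint.smul_some_eq_ite]
      change wedge (g 0 0 * z + g 0 1 * 1, g 1 0 * z + g 1 1 * 1) _ = 0
      split_ifs with h
      · change (g 0 0 * z + g 0 1 * 1) * 0 - 1 * (g 1 0 * z + g 1 1 * 1) = 0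
        linear_combination -h
      · change (g 0 0 * z + g 0 1 * 1) * 1 -
          ((g 0 0 * z + g 0 1) / (g 1 0 * z + g 1 1)) * (g 1 0 * z + g 1 1 * 1) = 0
        rw [mul_one, mul_one, mul_one, div_mul_cancel₀ _ h, sub_self]
  choose μ hμ using key
  refine ⟨_, hD, μ, fun x y => ?_⟩
  have h := congrArg₂ wedge (hμ x) (hμ y)
  rw [wedge_smul_left, wedge_smul_right] at h
  change _ = μ x * μ y * wedge (homCoord (g • x)) (homCoord (g • y))
  rw [mul_assoc, ← h, homDiff_eq_wedge]
  simp only [G, wedge]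
  ring

/-! ### The lattice Schwarzian KP equation -/

theorem mobius_apply_eq {σ σ' r : MobiusGroup} (h : σ' = r * σ) (x : OnePoint ℂ) :
    r.1 (σ.1 x) = σ'.1 x := by
  subst h; rfl

theorem proposition2 (k ρ : ℂ) (hρ : ρ ^ 2 = k) (α β γ κ ζ₀ : ℂ)
    (hακ : Q4Finite k α κ) (hβκ : Q4Finite k β κ) (hγκ : Q4Finite k γ κ)
    (hαβ : Q4Finite k α β) (hβγ : Q4Finite k β γ) (hγα : Q4Finite k γ α)
    (u φ : LatticeFun (OnePoint ℂ))
    (hu : (q4System k α β γ κ).IsSolution u)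
    (hns : (q4System k α β γ κ).IsNonsingular u)
    (hφ : (q4System k α β γ κ).IsSchwarzianVariable
      (q4SingularSolution k ρ α β γ ζ₀) u φ) :
    SatisfiesLatticeSKP φ := by
  obtain ⟨s, ⟨r₁, r₂, r₃, hs⟩, hφ⟩ := hφ
  have hsφ : ∀ n m l, (s n m l).1 (φ n m l) = q4SingularSolution k ρ α β γ ζ₀ n m l := by
    intro n m l
    rw [hφ]
    exact (s n m l).1.apply_symm_apply _
  simp only [BacklundSystem3D.IsSolution, BacklundSystem3D.IsNonsingular, q4System,
    biquadratic_q4Form, neg_ne_zero, QuadForm.Vanishes] at hu hns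
  simp only [q4System] at hs
  intro n m l
  suffices h : skpNum φ n m l = skpDen φ n m l from ⟨h, fun h0 => by rw [h, div_self h0]⟩
  obtain ⟨P₁₂, P₂₃, P₃₁⟩ := hu n m l
  obtain ⟨⟨R₁, S₁⟩, ⟨R₂, S₂⟩, ⟨R₃, S₃⟩⟩ := hs n m l
  obtain ⟨-, ⟨R₂₁, S₂₁⟩, ⟨R₃₁, S₃₁⟩⟩ := hs (n + 1) m l
  obtain ⟨⟨R₁₂, S₁₂⟩, -, ⟨R₃₂, S₃₂⟩⟩ := hs n (m + 1) l
  obtain ⟨⟨R₁₃, S₁₃⟩, ⟨R₂₃, S₂₃⟩, -⟩ := hs n m (l + 1)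
  obtain ⟨d₁, d₂, d₃⟩ := hns n m l
  obtain ⟨-, d₂₁, d₃₁⟩ := hns (n + 1) m l
  obtain ⟨d₁₂, -, d₃₂⟩ := hns n (m + 1) l
  obtain ⟨d₁₃, d₂₃, -⟩ := hns n m (l + 1)
  -- the images under `s` of the six values of `φ`
  obtain ⟨μ₁, M₁⟩ := R₁.exists_riccati_eq ((mobius_apply_eq S₁ _).trans (hsφ _ _ _))
  obtain ⟨μ₂, M₂⟩ := R₂.exists_riccati_eq ((mobius_apply_eq S₂ _).trans (hsφ _ _ _))
  obtain ⟨μ₃, M₃⟩ := R₃.exists_riccati_eq ((mobius_apply_eq S₃ _).trans (hsφ _ _ _))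
  have two : ∀ {α β : ℂ} {u u₁ u₁₂ : OnePoint ℂ} {r r' σ σ₁ σ₁₂ : MobiusGroup} {x w : OnePoint ℂ},
      (q4Form k α κ).IsRiccatiMap u u₁ r → (q4Form k β κ).IsRiccatiMap u₁ u₁₂ r' →
      σ₁ = r * σ → σ₁₂ = r' * σ₁ → σ₁₂.1 x = w →
      ∃ ν : ℂ, riccati k β κ (homCoord u₁) (homCoord u₁₂)
        (riccati k α κ (homCoord u) (homCoord u₁) (homCoord (σ.1 x))) = ν • homCoord w := by
    intro α β u u₁ u₁₂ r r' σ σ₁ σ₁₂ x w hr hr' hσ hσ' hw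
    obtain ⟨a, ha⟩ := hr.exists_riccati_eq (mobius_apply_eq hσ x)
    obtain ⟨b, hb⟩ := hr'.exists_riccati_eq ((mobius_apply_eq hσ' x).trans hw)
    exact ⟨a * b, by rw [ha, riccati_smul, hb, smul_smul]⟩
  obtain ⟨ν₁₂, N₁₂⟩ := two R₁ R₂₁ S₁ S₂₁ (hsφ _ _ _)
  obtain ⟨ν₂₁, N₂₁⟩ := two R₂ R₁₂ S₂ S₁₂ (hsφ _ _ _)
  obtain ⟨ν₂₃, N₂₃⟩ := two R₂ R₃₂ S₂ S₃₂ (hsφ _ _ _)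
  obtain ⟨ν₃₂, N₃₂⟩ := two R₃ R₂₃ S₃ S₂₃ (hsφ _ _ _)
  obtain ⟨ν₃₁, N₃₁⟩ := two R₃ R₁₃ S₃ S₁₃ (hsφ _ _ _)
  obtain ⟨ν₁₃, N₁₃⟩ := two R₁ R₃₁ S₁ S₃₁ (hsφ _ _ _)
  obtain ⟨z₁, τ₁, τ₁', A₁, B₁, C₁⟩ := exists_wedge_eq hακ hβκ hαβ P₁₂ d₁ d₂ d₂₁ d₁₂
    (homCoord_ne_zero _) M₁ M₂ N₁₂ N₂₁
  obtain ⟨z₂, τ₂, τ₂', A₂, B₂, C₂⟩ := exists_wedge_eq hβκ hγκ hβγ P₂₃ d₂ d₃ d₃₂ d₂₃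
    (homCoord_ne_zero _) M₂ M₃ N₂₃ N₃₂
  obtain ⟨z₃, τ₃, τ₃', A₃, B₃, C₃⟩ := exists_wedge_eq hγκ hακ hγα P₃₁ d₃ d₁ d₁₃ d₃₁
    (homCoord_ne_zero _) M₃ M₁ N₃₁ N₁₃
  -- the values of `w`
  obtain ⟨x, hx⟩ : ∃ x, x = ζ₀ + n * α + m * β + l * γ := ⟨_, rfl⟩
  have w : ∀ n' m' l' y, ζ₀ + (n' : ℤ) * α + (m' : ℤ) * β + (l' : ℤ) * γ = y →
      homCoord (q4SingularSolution k ρ α β γ ζ₀ n' m' l') = snPoint k ρ y := by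
    rintro n' m' l' _ rfl
    rfl
  rw [w (n + 1) m l (x + α) (by rw [hx]; push_cast; ring),
    w (n + 1) (m + 1) l (x + α + β) (by rw [hx]; push_cast; ring)] at A₁
  rw [w n (m + 1) l (x + β) (by rw [hx]; push_cast; ring),
    w (n + 1) (m + 1) l (x + α + β) (by rw [hx]; push_cast; ring)] at B₁
  rw [w n (m + 1) l (x + β) (by rw [hx]; push_cast; ring),
    w n (m + 1) (l + 1) (x + β + γ) (by rw [hx]; push_cast; ring)] at A₂
  rw [w n m (l + 1) (x + γ) (by rw [hx]; push_cast; ring),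
    w n (m + 1) (l + 1) (x + β + γ) (by rw [hx]; push_cast; ring)] at B₂
  rw [w n m (l + 1) (x + γ) (by rw [hx]; push_cast; ring),
    w (n + 1) m (l + 1) (x + α + γ) (by rw [hx]; push_cast; ring)] at A₃
  rw [w (n + 1) m l (x + α) (by rw [hx]; push_cast; ring),
    w (n + 1) m (l + 1) (x + α + γ) (by rw [hx]; push_cast; ring)] at B₃
  obtain ⟨D, hD, μ, hμ⟩ := exists_homDiff_eq (s n m l)
  apply mul_left_cancel₀ (pow_ne_zero 3 hD)
  simp only [← homDiff_eq_wedge] at A₁ A₂ A₃ B₁ B₂ B₃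
  have num : D ^ 3 * skpNum φ n m l = (D * homDiff (φ n (m + 1) l) (φ (n + 1) (m + 1) l)) *
      (D * homDiff (φ n m (l + 1)) (φ n (m + 1) (l + 1))) *
      (D * homDiff (φ (n + 1) m l) (φ (n + 1) m (l + 1))) := by
    rw [skpNum]; ring
  have den : D ^ 3 * skpDen φ n m l = (D * homDiff (φ (n + 1) m l) (φ (n + 1) (m + 1) l)) *
      (D * homDiff (φ n (m + 1) l) (φ n (m + 1) (l + 1))) *
      (D * homDiff (φ n m (l + 1)) (φ (n + 1) m (l + 1))) := by
    rw [skpDen]; ring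
  rw [num, den]
  simp only [hμ, A₁, A₂, A₃, B₁, B₂, B₃]
  by_cases h0 : jacobiSnFun k α = 0
  · have h1 := z₁.1 h0
    rw [q4Form_snPoint_eq_zero hγκ (z₂.1 h1), q4Form_snPoint_eq_zero hβκ h1]
    ring
  · have h1 := mt z₁.2 h0
    have h2 := mt z₂.2 h1
    have hτ : τ₁' * τ₂' * τ₃' = τ₁ * τ₂ * τ₃ := by
      have e₁ := edgePoly_ne_zero hακ d₁
      have e₂ := edgePoly_ne_zero hβκ d₂
      have e₃ := edgePoly_ne_zero hγκ d₃
      apply mul_left_cancel₀ (mul_ne_zero (mul_ne_zero (mul_ne_zero h0 e₂) (mul_ne_zero h1 e₃))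
        (mul_ne_zero h2 e₁))
      have := congrArg₂ (· * ·) (congrArg₂ (· * ·) C₁ C₂) C₃
      linear_combination this
    have key := q4Form_snPoint_cyclic hρ hακ hβκ hγκ x (homCoord (u (n + 1) m l))
      (homCoord (u n (m + 1) l)) (homCoord (u n m (l + 1))) (homCoord (u (n + 1) (m + 1) l))
      (homCoord (u n (m + 1) (l + 1))) (homCoord (u (n + 1) m (l + 1)))
    have := congrArg₂ (· * ·) hτ key
    linear_combination (μ (φ (n + 1) m l) * μ (φ n (m + 1) l) * μ (φ n m (l + 1)) *
      μ (φ (n + 1) (m + 1) l) * μ (φ n (m + 1) (l + 1)) * μ (φ (n + 1) m (l + 1)) *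
      μ₁ * μ₂ * μ₃) * this
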